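/- Call a finite set $T\subset\mathbb R^2$ \emph{in convex position} if every point of $T$ lies on the boundary of the convex hull of $T$. A \emph{convex cover} of a finite set $S\subset\mathbb R^2$ is a set of subsets of $S$, each in convex position, whose union is $S$; the \emph{convex cover number} $\kappa_c(S)$ is the minimum number of subsets in a convex cover of $S$. Theorem. The convex cover number can be approximated within a factor $O(\log n)$ in polynomial time. Precisely: there are a constant $C$, a polynomial $P$ and a single real RAM program (exact unit-cost real arithmetic $+,-,\times,\div$ and comparisons with real constants $0,1$ only; unit-cost addition, truncated subtraction and comparison of natural numbers; indirect addressing) such that for every $n\ge 0$ and every set $S$ of $n$ points in the plane, given as a list of the coordinates of its points, the program halts after at most $P(n)$ steps and outputs a number $k$ with $$\kappa_c(S)\le k\le (1+C\log n)\,\kappa_c(S)$$ together with a convex cover of $S$ by at most $k$ subsets, given by labelling each point of $S$ with one of the numbers $0,\dots,k-1$ such that the points with any given label are in convex position. (For $n=0$ read $k=\kappa_c(S)=0$.) -/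

import Mathlib

/-- The Euclidean plane. -/
abbrev Plane : Type := EuclideanSpace ℝ (Fin 2)

/-- A planar point set is in convex position (is a convex chain) if it has a single convex layer,
that is, if each of its points lies on the boundary of its convex hull. -/
def ConvexPosition (T : Set Plane) : Prop :=
  T ⊆ frontier (convexHull ℝ T)

/-- A convex cover of `S`: a family of subsets of `S`, each in convex position, whose union
covers `S`. -/
structure IsConvexCover (S : Set Plane) (F : Set (Set Plane)) : Prop where
  subset : ∀ T ∈ F, T ⊆ S
  convexPosition : ∀ T ∈ F, ConvexPosition T
  covers : S ⊆ ⋃₀ F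

/-- The convex cover number `κ_c(S)` of a finite planar point set `S`: the minimum number of
subsets in a convex cover of `S`. (For finite `S` the singletons form a finite convex cover.) -/
noncomputable def convexCoverNumber (S : Set Plane) : ℕ :=
  sInf {k : ℕ | ∃ F : Set (Set Plane), IsConvexCover S F ∧ F.Finite ∧ F.ncard = k}

/-! ### The real RAM

Programs of a random access machine with integer (natural number) memory and real memory.
Memory is organised in arrays, numbered by constants of the program, with computed indices.
Integers can be added, subtracted and compared (there is no unit-cost integer multiplication, so
integers cannot grow faster than exponentially). Reals can be added, subtracted, multiplied,
divided and compared exactly; there is no rounding operation, no transfer of reals into integer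
memory, and the only real constants are `0` and `1`. Every operation, memory access, constant,
test and assignment takes one time unit. -/

namespace RealRAM

/-- A memory state: `int a i` and `real a i` are the contents of the `i`-th cell of the `a`-th
integer array and of the `a`-th real array. -/
structure State : Type where
  int : ℕ → ℕ → ℕ
  real : ℕ → ℕ → ℝ

/-- Write `v` into cell `i` of integer array `a`. -/
def State.setInt (s : State) (a i v : ℕ) : State :=
  { s with int := Function.update s.int a (Function.update (s.int a) i v) }

/-- Write `v` into cell `i` of real array `a`. -/
noncomputable def State.setReal (s : State) (a i : ℕ) (v : ℝ) : State :=
  { s with real := Function.update s.real a (Function.update (s.real a) i v) }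

/-- Integer expressions; `get a i` reads the cell of array `a` whose index is the value of `i`,
and `sub` is truncated subtraction. -/
inductive IntExpr : Type where
  | const (c : ℕ) : IntExpr
  | get (a : ℕ) (i : IntExpr) : IntExpr
  | add (e f : IntExpr) : IntExpr
  | sub (e f : IntExpr) : IntExpr

/-- The value of an integer expression. -/
def IntExpr.eval (s : State) : IntExpr → ℕ
  | .const c => c
  | .get a i => s.int a (i.eval s)
  | .add e f => e.eval s + f.eval s
  | .sub e f => e.eval s - f.eval s

/-- The time needed to evaluate an integer expression: one unit per operation. -/
def IntExpr.cost : IntExpr → ℕ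
  | .const _ => 1
  | .get _ i => i.cost + 1
  | .add e f => e.cost + f.cost + 1
  | .sub e f => e.cost + f.cost + 1

/-- Real expressions. -/
inductive RealExpr : Type where
  | zero : RealExpr
  | one : RealExpr
  | get (a : ℕ) (i : IntExpr) : RealExpr
  | add (e f : RealExpr) : RealExpr
  | sub (e f : RealExpr) : RealExpr
  | mul (e f : RealExpr) : RealExpr
  | div (e f : RealExpr) : RealExpr

/-- The value of a real expression (with the convention `x / 0 = 0`). -/
noncomputable def RealExpr.eval (s : State) : RealExpr → ℝ
  | .zero => 0
  | .one => 1
  | .get a i => s.real a (i.eval s)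
  | .add e f => e.eval s + f.eval s
  | .sub e f => e.eval s - f.eval s
  | .mul e f => e.eval s * f.eval s
  | .div e f => e.eval s / f.eval s

/-- The time needed to evaluate a real expression: one unit per operation. -/
def RealExpr.cost : RealExpr → ℕ
  | .zero => 1
  | .one => 1
  | .get _ i => i.cost + 1
  | .add e f => e.cost + f.cost + 1
  | .sub e f => e.cost + f.cost + 1
  | .mul e f => e.cost + f.cost + 1
  | .div e f => e.cost + f.cost + 1

/-- Tests: comparisons of integers or of reals, and Boolean combinations of tests. -/
inductive Test : Type where
  | intLT (e f : IntExpr) : Test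
  | realLT (e f : RealExpr) : Test
  | not (b : Test) : Test
  | and (b c : Test) : Test

/-- The truth value of a test. -/
def Test.Holds (s : State) : Test → Prop
  | .intLT e f => e.eval s < f.eval s
  | .realLT e f => e.eval s < f.eval s
  | .not b => ¬ b.Holds s
  | .and b c => b.Holds s ∧ c.Holds s

/-- The time needed to evaluate a test. -/
def Test.cost : Test → ℕ
  | .intLT e f => e.cost + f.cost + 1
  | .realLT e f => e.cost + f.cost + 1
  | .not b => b.cost + 1
  | .and b c => b.cost + c.cost + 1

/-- Programs; `setInt a i e` and `setReal a i e` assign the value of `e` to the cell of array `a`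
whose index is the value of `i`. -/
inductive Program : Type where
  | skip : Program
  | setInt (a : ℕ) (i e : IntExpr) : Program
  | setReal (a : ℕ) (i : IntExpr) (e : RealExpr) : Program
  | seq (c d : Program) : Program
  | ifThenElse (b : Test) (c d : Program) : Program
  | whileDo (b : Test) (c : Program) : Program

/-- `Runs c s t s'`: started in state `s`, the program `c` halts after exactly `t` time units, in
state `s'`. -/
inductive Runs : Program → State → ℕ → State → Prop where
  | skip (s : State) : Runs .skip s 1 s
  | setInt (a : ℕ) (i e : IntExpr) (s : State) :
      Runs (.setInt a i e) s (i.cost + e.cost + 1) (s.setInt a (i.eval s) (e.eval s))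
  | setReal (a : ℕ) (i : IntExpr) (e : RealExpr) (s : State) :
      Runs (.setReal a i e) s (i.cost + e.cost + 1) (s.setReal a (i.eval s) (e.eval s))
  | seq {c d : Program} {s s' s'' : State} {t t' : ℕ} :
      Runs c s t s' → Runs d s' t' s'' → Runs (.seq c d) s (t + t') s''
  | ifTrue {b : Test} {c d : Program} {s s' : State} {t : ℕ} :
      b.Holds s → Runs c s t s' → Runs (.ifThenElse b c d) s (b.cost + t + 1) s'
  | ifFalse {b : Test} {c d : Program} {s s' : State} {t : ℕ} :
      ¬ b.Holds s → Runs d s t s' → Runs (.ifThenElse b c d) s (b.cost + t + 1) s'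
  | whileTrue {b : Test} {c : Program} {s s' s'' : State} {t t' : ℕ} :
      b.Holds s → Runs c s t s' → Runs (.whileDo b c) s' t' s'' →
        Runs (.whileDo b c) s (b.cost + t + t' + 1) s''
  | whileFalse {b : Test} {c : Program} {s : State} :
      ¬ b.Holds s → Runs (.whileDo b c) s (b.cost + 1) s

/-- The initial state for the input `p 0, …, p (n - 1)`: cell `0` of integer array `0` holds `n`,
the real arrays `0` and `1` hold the `x`- and the `y`-coordinates of the points, and all other
cells are `0`. -/
noncomputable def inputState {n : ℕ} (p : Fin n → Plane) : State where
  int a i := if a = 0 ∧ i = 0 then n else 0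
  real a i :=
    if h : i < n then
      if a = 0 then p ⟨i, h⟩ 0 else if a = 1 then p ⟨i, h⟩ 1 else 0
    else 0

/-- The number computed by a halted program: the contents of cell `0` of integer array `0`. -/
def State.number (s : State) : ℕ := s.int 0 0

/-- The label that a halted program has given to the `i`-th input point: the contents of cell `i`
of integer array `1`. -/
def State.label (s : State) (i : ℕ) : ℕ := s.int 1 i

end RealRAM

/-- The set of those of the points `p 0, …, p (n - 1)` that carry the label `c` in the output. -/
def labelClass {n : ℕ} (p : Fin n → Plane) (s : RealRAM.State) (c : ℕ) : Set Plane :=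
  {x | ∃ i : Fin n, p i = x ∧ s.label i = c}

/-! ### Lexicographic chains with right turns -/

/-! The program is the greedy set cover algorithm, with convex sets replaced by lexicographically
monotone paths that never turn left ("chains"). As long as points are unlabelled, a longest chain
among them receives a new label.

Chains are easy to optimise over because their convexity is local. Among lexicographically positive
directions turning right is transitive (`LexPos.cross_trans`), so whether a chain extends to a point
depends only on its last edge, and yet all its points have supporting lines (`ChainTo.supported`). A
longest chain is thus found by dynamic programming over triples (number of edges, last edge).

Little is lost by this restriction. The line through the lexicographic extremes of a set in convex
position splits it into the points on the line and those on either side. Each of the three parts is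
a chain, one of them after a point reflection (`Supported.card_le`). If the longest chain in the
unlabelled set `R` has `K` points, then summing over an optimal cover by `κ` sets gives `|R| ≤ 3κK`
(`card_le_of_chains`). Every labelling round therefore removes at least a fraction `1 / (3κ)` of
`R`. Before the last of `k` such rounds some point is still unlabelled, so `1 ≤ n (1 - 1/(3κ))^(k-1)
≤ n exp(-(k-1)/(3κ))`, which yields `k ≤ 1 + 3κ log n` (`greedy_rounds_le`).

Convex position enters only through supporting lines (`convexPosition_of_support`,
`ConvexPosition.exists_support`). The machine is handled through a language of bounded loops: its
programs always halt, in time polynomial in the loop bound (`runs_compile`), and are verified with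
an invariant rule (`exec_loop`). -/

/-- The vector `(u, v)` is lexicographically positive. -/
def LexPos (u v : ℝ) : Prop := 0 < u ∨ (u = 0 ∧ 0 < v)

theorem lexPos_or_lexPos_neg {u v : ℝ} (h : u ≠ 0 ∨ v ≠ 0) : LexPos u v ∨ LexPos (-u) (-v) := by
  unfold LexPos
  rcases lt_trichotomy u 0 with hu | hu | hu
  · right; left; linarith
  · rcases lt_trichotomy v 0 with hv | hv | hv
    · right; right; constructor <;> linarith
    · simp [hu, hv] at h
    · left; right; exact ⟨hu, hv⟩
  · left; left; exact hu

theorem LexPos.ne_zero {u v : ℝ} (h : LexPos u v) : u ≠ 0 ∨ v ≠ 0 := by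
  rcases h with h | h
  · exact Or.inl h.ne'
  · exact Or.inr h.2.ne'

/-- Among lexicographically positive vectors, turning right is transitive. -/
theorem LexPos.cross_trans {u₁ u₂ v₁ v₂ w₁ w₂ : ℝ} (hu : LexPos u₁ u₂) (hv : LexPos v₁ v₂)
    (hw : LexPos w₁ w₂) (huv : u₁ * v₂ - u₂ * v₁ ≤ 0) (hvw : v₁ * w₂ - v₂ * w₁ ≤ 0) :
    u₁ * w₂ - u₂ * w₁ ≤ 0 := by
  have hu₁ : 0 ≤ u₁ := by rcases hu with h | h <;> linarith
  have hw₁ : 0 ≤ w₁ := by rcases hw with h | h <;> linarith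
  rcases hv with hv | ⟨hv₁, hv₂⟩
  · have e : v₁ * (u₁ * w₂ - u₂ * w₁)
        = u₁ * (v₁ * w₂ - v₂ * w₁) + w₁ * (u₁ * v₂ - u₂ * v₁) := by ring
    have : v₁ * (u₁ * w₂ - u₂ * w₁) ≤ 0 := by
      rw [e]
      have := mul_nonpos_of_nonneg_of_nonpos hu₁ hvw
      have := mul_nonpos_of_nonneg_of_nonpos hw₁ huv
      linarith
    exact nonpos_of_mul_nonpos_right this hv
  -- If `v` points straight up, `u` cannot turn right into it unless `u` points straight up too.
  · subst hv₁
    rcases hu with hu | ⟨hu, hu₂⟩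
    · have := mul_pos hu hv₂
      linarith
    · subst hu
      have := mul_nonneg hu₂.le hw₁
      linarith

/-- The point with index `i` lexicographically precedes the point with index `j`. -/
def LexLT (X Y : ℕ → ℝ) (i j : ℕ) : Prop := X i < X j ∨ (X i = X j ∧ Y i < Y j)

theorem lexLT_iff {X Y : ℕ → ℝ} {i j : ℕ} : LexLT X Y i j ↔ LexPos (X j - X i) (Y j - Y i) := by
  simp only [LexLT, LexPos, sub_pos, sub_eq_zero]
  tauto

/-- Point reflection reverses the lexicographic order and keeps orientations, so decreasing chains
and lower sides reduce to increasing chains and upper sides. -/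
theorem lexLT_neg {X Y : ℕ → ℝ} {i j : ℕ} :
    LexLT (fun i => -X i) (fun i => -Y i) i j ↔ LexLT X Y j i := by
  simp only [LexLT, neg_lt_neg_iff, neg_inj]
  tauto

theorem LexLT.trans {X Y : ℕ → ℝ} {i j k : ℕ} (h : LexLT X Y i j) (h' : LexLT X Y j k) :
    LexLT X Y i k := by
  unfold LexLT at *
  rcases h with h | ⟨h, h₂⟩ <;> rcases h' with h' | ⟨h', h₂'⟩
  · left; linarith
  · left; linarith
  · left; linarith
  · right; constructor <;> linarith

theorem LexLT.irrefl {X Y : ℕ → ℝ} {i : ℕ} : ¬ LexLT X Y i i := by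
  simp [LexLT]

theorem LexLT.asymm {X Y : ℕ → ℝ} {i j : ℕ} (h : LexLT X Y i j) : ¬ LexLT X Y j i :=
  fun h' => LexLT.irrefl (h.trans h')

/-- The orientation determinant of the path through the points `h`, `i`, `j`; it is negative for
a right turn. -/
def turnDet (X Y : ℕ → ℝ) (h i j : ℕ) : ℝ :=
  (X i - X h) * (Y j - Y i) - (Y i - Y h) * (X j - X i)

theorem turnDet_neg {X Y : ℕ → ℝ} {h i j : ℕ} :
    turnDet (fun i => -X i) (fun i => -Y i) h i j = turnDet X Y h i j := by
  unfold turnDet; ring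

/-- A chain arriving at `i` from `h` may continue to `j`: the path does not turn left and keeps its
lexicographic direction. The degenerate edge `h = i` has both directions. -/
def CanContinue (X Y : ℕ → ℝ) (h i j : ℕ) : Prop :=
  turnDet X Y h i j ≤ 0 ∧
    ((¬ LexLT X Y i h ∧ LexLT X Y i j) ∨ (¬ LexLT X Y h i ∧ LexLT X Y j i))

theorem canContinue_neg {X Y : ℕ → ℝ} {h i j : ℕ} :
    CanContinue (fun i => -X i) (fun i => -Y i) h i j ↔ CanContinue X Y h i j := by
  simp only [CanContinue, turnDet_neg, lexLT_neg]
  tauto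

/-- `ChainTo X Y R m i j A`: the points with indices in `A ⊆ R` form a chain with `m` edges
(`m + 1` points) that ends in `j` and whose last edge comes from `i` (`i = j` if `m = 0`). -/
inductive ChainTo (X Y : ℕ → ℝ) (R : Finset ℕ) : ℕ → ℕ → ℕ → Finset ℕ → Prop where
  | single {i : ℕ} : i ∈ R → ChainTo X Y R 0 i i {i}
  | extend {m h i j : ℕ} {A : Finset ℕ} : ChainTo X Y R m h i A → j ∈ R →
      CanContinue X Y h i j → ChainTo X Y R (m + 1) i j (insert j A)

theorem ChainTo.neg {X Y : ℕ → ℝ} {R : Finset ℕ} {m i j : ℕ} {A : Finset ℕ}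
    (h : ChainTo X Y R m i j A) : ChainTo (fun i => -X i) (fun i => -Y i) R m i j A := by
  induction h with
  | single hi => exact .single hi
  | extend _ hj hc ih => exact .extend ih hj (canContinue_neg.2 hc)

theorem ChainTo.of_neg {X Y : ℕ → ℝ} {R : Finset ℕ} {m i j : ℕ} {A : Finset ℕ}
    (h : ChainTo (fun i => -X i) (fun i => -Y i) R m i j A) : ChainTo X Y R m i j A := by
  simpa using h.neg

theorem ChainTo.subset {X Y : ℕ → ℝ} {R : Finset ℕ} {m i j : ℕ} {A : Finset ℕ}
    (h : ChainTo X Y R m i j A) : A ⊆ R := by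
  induction h with
  | single hi => simpa using hi
  | extend _ hj _ ih => exact Finset.insert_subset hj ih

theorem ChainTo.target_mem {X Y : ℕ → ℝ} {R : Finset ℕ} {m i j : ℕ} {A : Finset ℕ}
    (h : ChainTo X Y R m i j A) : j ∈ A := by
  cases h <;> simp

theorem ChainTo.source_mem {X Y : ℕ → ℝ} {R : Finset ℕ} {m i j : ℕ} {A : Finset ℕ}
    (h : ChainTo X Y R m i j A) : i ∈ A := by
  cases h with
  | single hi => simp
  | extend h _ _ => exact Finset.mem_insert_of_mem h.target_mem

/-! ### Supporting lines of chains -/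

/-- Every point indexed by `A` admits a line through it that has all of `A` on its right side. -/
def Supported (X Y : ℕ → ℝ) (A : Finset ℕ) : Prop :=
  ∀ a ∈ A, ∃ u v : ℝ, (u ≠ 0 ∨ v ≠ 0) ∧ ∀ b ∈ A, u * (Y b - Y a) - v * (X b - X a) ≤ 0

theorem Supported.neg {X Y : ℕ → ℝ} {A : Finset ℕ} (h : Supported X Y A) :
    Supported (fun i => -X i) (fun i => -Y i) A := by
  intro a ha
  obtain ⟨u, v, h0, hs⟩ := h a ha
  refine ⟨-u, -v, by simpa using h0, fun b hb => ?_⟩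
  have := hs b hb
  linarith

theorem Supported.of_neg {X Y : ℕ → ℝ} {A : Finset ℕ}
    (h : Supported (fun i => -X i) (fun i => -Y i) A) : Supported X Y A := by
  simpa using h.neg

theorem Supported.mono {X Y : ℕ → ℝ} {A B : Finset ℕ} (h : Supported X Y A) (hB : B ⊆ A) :
    Supported X Y B := by
  intro a ha
  obtain ⟨u, v, h0, hs⟩ := h a (hB ha)
  exact ⟨u, v, h0, fun b hb => hs b (hB hb)⟩

/-- The invariant of a lexicographically increasing chain on `A` with last edge from `i` to `j`. -/
structure IncreasingChain (X Y : ℕ → ℝ) (i j : ℕ) (A : Finset ℕ) : Prop where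
  lt : LexLT X Y i j
  mem : j ∈ A
  le : ∀ a ∈ A, a = j ∨ LexLT X Y a j
  right : ∀ a ∈ A, (X j - X i) * (Y a - Y j) - (Y j - Y i) * (X a - X j) ≤ 0
  -- The middle condition, that the supporting direction turns right into the last edge, is what
  -- lets the same line survive an extension.
  support : ∀ a ∈ A, ∃ u v : ℝ, LexPos u v ∧ u * (Y j - Y i) - v * (X j - X i) ≤ 0 ∧
    ∀ b ∈ A, u * (Y b - Y a) - v * (X b - X a) ≤ 0

theorem IncreasingChain.supported {X Y : ℕ → ℝ} {i j : ℕ} {A : Finset ℕ}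
    (h : IncreasingChain X Y i j A) : Supported X Y A := by
  intro a ha
  obtain ⟨u, v, h0, -, hs⟩ := h.support a ha
  exact ⟨u, v, h0.ne_zero, hs⟩

theorem IncreasingChain.pair {X Y : ℕ → ℝ} {i j : ℕ} (h : LexLT X Y i j) :
    IncreasingChain X Y i j {j, i} := by
  refine ⟨h, by simp, by simp [h], fun a ha => ?_, fun a ha => ⟨_, _, lexLT_iff.1 h, by linarith, ?_⟩⟩
  · simp only [Finset.mem_insert, Finset.mem_singleton] at ha
    rcases ha with rfl | rfl <;> linarith
  · intro b hb
    simp only [Finset.mem_insert, Finset.mem_singleton] at ha hb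
    rcases ha with rfl | rfl <;> rcases hb with rfl | rfl <;> linarith

theorem IncreasingChain.notMem {X Y : ℕ → ℝ} {h i j : ℕ} {A : Finset ℕ}
    (H : IncreasingChain X Y h i A) (hc : CanContinue X Y h i j) : j ∉ A := by
  intro hj
  have hij : LexLT X Y i j := by
    rcases hc.2 with h' | h'
    · exact h'.2
    · exact absurd H.lt h'.1
  rcases H.le j hj with rfl | h'
  · exact LexLT.irrefl hij
  · exact hij.asymm h'

/-- At the new point the line of the new edge supports: the direction from an old point to `i` turns
right into the old edge, hence into the new one. An old supporting direction at `a` also turns right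
into the new edge; since `j - a = (i - a) + (j - i)`, the new point lies on the right side as well.
-/
theorem IncreasingChain.extend {X Y : ℕ → ℝ} {h i j : ℕ} {A : Finset ℕ}
    (H : IncreasingChain X Y h i A) (hc : CanContinue X Y h i j) :
    IncreasingChain X Y i j (insert j A) := by
  have hij : LexLT X Y i j := by
    rcases hc.2 with h' | h'
    · exact h'.2
    · exact absurd H.lt h'.1
  have hdet : (X i - X h) * (Y j - Y i) - (Y i - Y h) * (X j - X i) ≤ 0 := hc.1
  have hright : ∀ a ∈ insert j A,
      (X j - X i) * (Y a - Y j) - (Y j - Y i) * (X a - X j) ≤ 0 := by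
    intro a ha
    rcases Finset.mem_insert.1 ha with rfl | ha
    · linarith
    rcases H.le a ha with rfl | hai
    · linarith
    have h1 := H.right a ha
    have := (lexLT_iff.1 hai).cross_trans (lexLT_iff.1 H.lt) (lexLT_iff.1 hij)
      (by linarith) hdet
    linarith
  refine ⟨hij, Finset.mem_insert_self j A, fun a ha => ?_, hright, fun a ha => ?_⟩
  · rcases Finset.mem_insert.1 ha with rfl | ha
    · exact Or.inl rfl
    rcases H.le a ha with rfl | hai
    · exact Or.inr hij
    · exact Or.inr (hai.trans hij)
  · rcases Finset.mem_insert.1 ha with rfl | ha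
    · exact ⟨_, _, lexLT_iff.1 hij, by linarith, hright⟩
    · obtain ⟨u, v, h0, h1, hs⟩ := H.support a ha
      have h2 := h0.cross_trans (lexLT_iff.1 H.lt) (lexLT_iff.1 hij) h1 hdet
      refine ⟨u, v, h0, h2, fun b hb => ?_⟩
      rcases Finset.mem_insert.1 hb with rfl | hb
      · have h3 := hs i H.mem
        linarith
      · exact hs b hb

/-- The first proper edge fixes the lexicographic direction for good, so no point recurs; a
decreasing chain is an increasing one after reflection. -/
theorem ChainTo.card_and_shape {X Y : ℕ → ℝ} {R : Finset ℕ} {m i j : ℕ} {A : Finset ℕ}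
    (h : ChainTo X Y R m i j A) : A.card = m + 1 ∧
      ((i = j ∧ A = {j}) ∨ IncreasingChain X Y i j A ∨
        IncreasingChain (fun i => -X i) (fun i => -Y i) i j A) := by
  induction h with
  | single hi => simp
  | @extend m h i j A _ hj hc ih =>
    obtain ⟨hcard, ⟨rfl, rfl⟩ | H | H⟩ := ih
    · rcases hc.2 with ⟨-, h'⟩ | ⟨-, h'⟩
      · refine ⟨?_, Or.inr (Or.inl (IncreasingChain.pair h'))⟩
        rw [Finset.card_insert_of_notMem, hcard]
        rintro hm
        rw [Finset.mem_singleton.1 hm] at h'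
        exact LexLT.irrefl h'
      · refine ⟨?_, Or.inr (Or.inr (IncreasingChain.pair (lexLT_neg.2 h')))⟩
        rw [Finset.card_insert_of_notMem, hcard]
        rintro hm
        rw [Finset.mem_singleton.1 hm] at h'
        exact LexLT.irrefl h'
    · refine ⟨?_, Or.inr (Or.inl (H.extend hc))⟩
      rw [Finset.card_insert_of_notMem (H.notMem hc), hcard]
    · refine ⟨?_, Or.inr (Or.inr (H.extend (canContinue_neg.2 hc)))⟩
      rw [Finset.card_insert_of_notMem (H.notMem (canContinue_neg.2 hc)), hcard]

theorem ChainTo.card_eq {X Y : ℕ → ℝ} {R : Finset ℕ} {m i j : ℕ} {A : Finset ℕ}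
    (h : ChainTo X Y R m i j A) : A.card = m + 1 := h.card_and_shape.1

theorem ChainTo.supported {X Y : ℕ → ℝ} {R : Finset ℕ} {m i j : ℕ} {A : Finset ℕ}
    (h : ChainTo X Y R m i j A) : Supported X Y A := by
  obtain ⟨-, ⟨rfl, rfl⟩ | H | H⟩ := h.card_and_shape
  · intro a ha
    refine ⟨1, 0, by simp, fun b hb => ?_⟩
    rw [Finset.mem_singleton.1 ha, Finset.mem_singleton.1 hb]
    simp
  · exact H.supported
  · exact H.supported.of_neg

/-! ### Long chains in supported sets -/

/-- Different indices in `A` belong to different points. -/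
def DistinctPoints (X Y : ℕ → ℝ) (A : Finset ℕ) : Prop :=
  ∀ i ∈ A, ∀ j ∈ A, X i = X j → Y i = Y j → i = j

theorem DistinctPoints.lexLT_or {X Y : ℕ → ℝ} {A : Finset ℕ} (hA : DistinctPoints X Y A) {i j : ℕ}
    (hi : i ∈ A) (hj : j ∈ A) : i = j ∨ LexLT X Y i j ∨ LexLT X Y j i := by
  have := hA i hi j hj
  unfold LexLT
  rcases lt_trichotomy (X i) (X j) with h | h | h
  · exact Or.inr (Or.inl (Or.inl h))
  · rcases lt_trichotomy (Y i) (Y j) with h' | h' | h'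
    · exact Or.inr (Or.inl (Or.inr ⟨h, h'⟩))
    · exact Or.inl (this h h')
    · exact Or.inr (Or.inr (Or.inr ⟨h.symm, h'⟩))
  · exact Or.inr (Or.inr (Or.inl h))

theorem DistinctPoints.exists_lexMax {X Y : ℕ → ℝ} {A : Finset ℕ} (hA : DistinctPoints X Y A)
    (hne : A.Nonempty) : ∃ j ∈ A, ∀ a ∈ A, a = j ∨ LexLT X Y a j := by
  obtain ⟨j, hj, hmax⟩ := A.exists_max_image (fun i => toLex (X i, Y i)) hne
  refine ⟨j, hj, fun a ha => ?_⟩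
  rcases hA.lexLT_or ha hj with h | h | h
  · exact Or.inl h
  · exact Or.inr h
  · have := hmax a ha
    rw [Prod.Lex.toLex_le_toLex] at this
    unfold LexLT at h
    rcases h with h | h <;> rcases this with h' | h' <;> simp only at h' <;> exfalso <;> linarith

theorem DistinctPoints.neg {X Y : ℕ → ℝ} {A : Finset ℕ} (hA : DistinctPoints X Y A) :
    DistinctPoints (fun i => -X i) (fun i => -Y i) A :=
  fun i hi j hj hx hy => hA i hi j hj (neg_inj.1 hx) (neg_inj.1 hy)

theorem DistinctPoints.mono {X Y : ℕ → ℝ} {A B : Finset ℕ} (hA : DistinctPoints X Y A)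
    (hB : B ⊆ A) : DistinctPoints X Y B :=
  fun i hi j hj => hA i (hB hi) j (hB hj)

/-- The points in lexicographic order form the path: remove the maximum, and append it to the chain
of the rest. The last two conclusions make that chain extendable in the increasing direction. -/
theorem exists_chainTo_of_right_turns {X Y : ℕ → ℝ} {R U : Finset ℕ} (hR : DistinctPoints X Y R)
    (hU : U ⊆ R) (hne : U.Nonempty)
    (hturn : ∀ h ∈ U, ∀ i ∈ U, ∀ j ∈ U, LexLT X Y h i → LexLT X Y i j → turnDet X Y h i j ≤ 0) :
    ∃ m h i, ChainTo X Y R m h i U ∧ ¬ LexLT X Y i h ∧ ∀ a ∈ U, a = i ∨ LexLT X Y a i := by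
  induction hc : U.card generalizing U with
  | zero => simp_all
  | succ c ih =>
    obtain ⟨j, hj, hmax⟩ := (hR.mono hU).exists_lexMax hne
    by_cases hne' : (U.erase j).Nonempty
    · have hsub : U.erase j ⊆ U := Finset.erase_subset j U
      obtain ⟨m, h, i, hch, hhi, hle⟩ := ih (hsub.trans hU) hne'
        (fun h hh i hi j hj => hturn h (hsub hh) i (hsub hi) j (hsub hj))
        (by rw [Finset.card_erase_of_mem hj, hc]; rfl)
      have hi := hch.target_mem
      have hh := hch.source_mem
      have hij : LexLT X Y i j := by
        rcases hmax i (hsub hi) with rfl | h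
        · simp at hi
        · exact h
      refine ⟨m + 1, i, j, ?_, hij.asymm, hmax⟩
      rw [← Finset.insert_erase hj]
      refine hch.extend (hU hj) ⟨?_, Or.inl ⟨hhi, hij⟩⟩
      -- If `h = i`, the chain so far is a single point and its degenerate edge has zero determinant
      -- with everything.
      rcases hle h hh with rfl | h'
      · unfold turnDet; linarith
      · exact hturn h (hsub hh) i (hsub hi) j hj h' hij
    · have hUj : U = {j} := by
        rw [← Finset.insert_erase hj, Finset.not_nonempty_iff_eq_empty.1 hne']
        rfl
      subst hUj
      exact ⟨0, j, j, .single (hU hj), LexLT.irrefl, hmax⟩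

/-- In a supported set, the points on one side of the line through the lexicographic extremes form
a chain. -/
theorem card_strict_side_le {X Y : ℕ → ℝ} {R A : Finset ℕ} (hR : DistinctPoints X Y R)
    (hA : A ⊆ R) (hs : Supported X Y A) {a b : ℕ} (ha : a ∈ A) (hb : b ∈ A)
    (hmin : ∀ x ∈ A, x = a ∨ LexLT X Y a x) (hmax : ∀ x ∈ A, x = b ∨ LexLT X Y x b) {K : ℕ}
    (hK : ∀ m i j B, ChainTo X Y R m i j B → m + 1 ≤ K) :
    (A.filter fun x => 0 < turnDet X Y a b x).card ≤ K := by
  rcases (A.filter fun x => 0 < turnDet X Y a b x).eq_empty_or_nonempty with h0 | hne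
  · simp [h0]
  have hsub : (A.filter fun x => 0 < turnDet X Y a b x) ⊆ A := Finset.filter_subset _ _
  obtain ⟨m, h, i, hch, -⟩ := exists_chainTo_of_right_turns hR (hsub.trans hA) hne (by
    intro h hh i hi j hj hhi hij
    replace hh := (Finset.mem_filter.1 hh).1
    have hdet := (Finset.mem_filter.1 hi).2
    replace hi := (Finset.mem_filter.1 hi).1
    replace hj := (Finset.mem_filter.1 hj).1
    obtain ⟨u, v, hne, hsup⟩ := hs i hi
    -- A supporting direction at `i` that is lexicographically positive lies between the edges `h i`
    -- and `i j`, which forces a right turn. A negative one, having both extremes `a` and `b` on its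
    -- right side, would place `i` on or to the right of the line `a b`.
    rcases lexPos_or_lexPos_neg hne with hp | hp
    · have h1 := hsup h hh
      have h2 := hsup j hj
      exact (lexLT_iff.1 hhi).cross_trans hp (lexLT_iff.1 hij) (by linarith) h2
    · exfalso
      have hai : LexLT X Y a i := by
        rcases hmin i hi with rfl | h'
        · rcases hmin h hh with rfl | h''
          · exact hhi
          · exact absurd hhi h''.asymm
        · exact h'
      have hib : LexLT X Y i b := by
        rcases hmax i hi with rfl | h'
        · rcases hmax j hj with rfl | h''
          · exact hij
          · exact absurd hij h''.asymm
        · exact h'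
      have h1 := hsup a ha
      have h2 := hsup b hb
      have := (lexLT_iff.1 hib).cross_trans hp (lexLT_iff.1 hai) (by linarith) (by linarith)
      unfold turnDet at hdet
      linarith)
  rw [hch.card_eq]
  exact hK _ _ _ _ hch

/-- A supported subset of `R` has at most three times as many points as the longest chain. -/
theorem Supported.card_le {X Y : ℕ → ℝ} {R A : Finset ℕ} (hR : DistinctPoints X Y R)
    (hA : A ⊆ R) (hs : Supported X Y A) {K : ℕ}
    (hK : ∀ m i j B, ChainTo X Y R m i j B → m + 1 ≤ K) : A.card ≤ 3 * K := by
  rcases A.eq_empty_or_nonempty with rfl | hne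
  · simp
  obtain ⟨b, hb, hmax⟩ := (hR.mono hA).exists_lexMax hne
  obtain ⟨a, ha, hmin'⟩ := (hR.mono hA).neg.exists_lexMax hne
  have hmin : ∀ x ∈ A, x = a ∨ LexLT X Y a x := by
    intro x hx
    simpa only [lexLT_neg] using hmin' x hx
  have hU := card_strict_side_le hR hA hs ha hb hmin hmax hK
  -- Reflection exchanges the extremes and turns the right side of the line into the left side of
  -- the reversed one.
  have hL := card_strict_side_le hR.neg hA hs.neg hb ha
    (by simpa only [lexLT_neg] using hmax) hmin' (fun m i j B h => hK m i j B h.of_neg)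
  have hM : (A.filter fun x => turnDet X Y a b x = 0).card ≤ K := by
    rcases (A.filter fun x => turnDet X Y a b x = 0).eq_empty_or_nonempty with h0 | hne
    · simp [h0]
    obtain ⟨m, h, i, hch, -⟩ := exists_chainTo_of_right_turns hR
      ((Finset.filter_subset _ _).trans hA) hne (by
      intro h hh i hi j hj hhi hij
      have hh0 := (Finset.mem_filter.1 hh).2
      have hi0 := (Finset.mem_filter.1 hi).2
      have hj0 := (Finset.mem_filter.1 hj).2
      replace hh := (Finset.mem_filter.1 hh).1
      replace hi := (Finset.mem_filter.1 hi).1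
      replace hj := (Finset.mem_filter.1 hj).1
      have hab : LexLT X Y a b := by
        rcases hmin h hh with rfl | h1
        · rcases hmax i hi with rfl | h2
          · exact hhi
          · exact hhi.trans h2
        · rcases hmax h hh with rfl | h2
          · exact h1
          · exact h1.trans h2
      unfold turnDet at hh0 hi0 hj0
      exact (lexLT_iff.1 hhi).cross_trans (lexLT_iff.1 hab) (lexLT_iff.1 hij)
        (by linarith) (by linarith))
    rw [hch.card_eq]
    exact hK _ _ _ _ hch
  have hcover : A ⊆ (A.filter fun x => 0 < turnDet X Y a b x) ∪
      ((A.filter fun x => turnDet X Y a b x = 0) ∪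
        A.filter fun x => 0 < turnDet (fun i => -X i) (fun i => -Y i) b a x) := by
    intro x hx
    have e : turnDet (fun i => -X i) (fun i => -Y i) b a x = - turnDet X Y a b x := by
      unfold turnDet; ring
    simp only [Finset.mem_union, Finset.mem_filter, hx, true_and, e, neg_pos]
    rcases lt_trichotomy (turnDet X Y a b x) 0 with h | h | h
    · exact Or.inr (Or.inr h)
    · exact Or.inr (Or.inl h)
    · exact Or.inl h
  have h1 := Finset.card_le_card hcover
  have h2 := Finset.card_union_le (A.filter fun x => 0 < turnDet X Y a b x)
    ((A.filter fun x => turnDet X Y a b x = 0) ∪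
        A.filter fun x => 0 < turnDet (fun i => -X i) (fun i => -Y i) b a x)
  have h3 := Finset.card_union_le (A.filter fun x => turnDet X Y a b x = 0)
    (A.filter fun x => 0 < turnDet (fun i => -X i) (fun i => -Y i) b a x)
  omega

/-! ### Convex position and supporting lines -/

/-- The supporting half-plane contains the hull. If `a` were interior, a short step along the outer
normal `(-v, u)` would stay in the hull but leave the half-plane. -/
theorem convexPosition_of_support {T : Set Plane}
    (h : ∀ a ∈ T, ∃ u v : ℝ, (u ≠ 0 ∨ v ≠ 0) ∧
      ∀ b ∈ T, u * (b 1 - a 1) - v * (b 0 - a 0) ≤ 0) : ConvexPosition T := by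
  intro a ha
  obtain ⟨u, v, hne, hs⟩ := h a ha
  refine ⟨subset_closure (subset_convexHull ℝ T ha), fun hint => ?_⟩
  have hconv : Convex ℝ {b : Plane | u * (b 1 - a 1) - v * (b 0 - a 0) ≤ 0} := by
    intro x hx y hy s t hs ht hst
    simp only [Set.mem_ofPred_eq, PiLp.add_apply, PiLp.smul_apply, smul_eq_mul] at *
    have e : t = 1 - s := by linarith
    subst e
    have h1 := mul_nonpos_of_nonneg_of_nonpos hs hx
    have h2 := mul_nonpos_of_nonneg_of_nonpos ht hy
    linarith
  have hsub : convexHull ℝ T ⊆ {b : Plane | u * (b 1 - a 1) - v * (b 0 - a 0) ≤ 0} :=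
    convexHull_min hs hconv
  have htend : Filter.Tendsto (fun t : ℝ => a + t • (!₂[-v, u] : Plane)) (nhds 0) (nhds a) := by
    have : Continuous (fun t : ℝ => a + t • (!₂[-v, u] : Plane)) := by fun_prop
    simpa using this.tendsto 0
  have hev : ∀ᶠ t in nhds (0 : ℝ), a + t • (!₂[-v, u] : Plane) ∈ convexHull ℝ T :=
    htend.eventually (mem_interior_iff_mem_nhds.1 hint)
  obtain ⟨ε, hε, hball⟩ := Metric.eventually_nhds_iff.1 hev
  have hm := Set.mem_ofPred_eq.mp (hsub (@hball (ε / 2) (by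
    rw [Real.dist_eq, sub_zero, abs_of_pos (by positivity)]; linarith)))
  simp at hm
  have hpos : 0 < u * u + v * v := by
    rcases hne with h | h
    · have := mul_self_pos.2 h; have := mul_self_nonneg v; linarith
    · have := mul_self_pos.2 h; have := mul_self_nonneg u; linarith
  have : ε / 2 * (u * u + v * v) ≤ 0 := by linarith
  have := mul_pos (half_pos hε) hpos
  linarith

/-- If the hull has interior points, Hahn–Banach separates `a` from the interior, and the inequality
passes to the closure. Otherwise `T` lies in a proper affine subspace, and a nonzero functional that
kills its direction is constant on `T`. -/
theorem ConvexPosition.exists_support {T : Set Plane} (hT : ConvexPosition T) {a : Plane}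
    (ha : a ∈ T) : ∃ u v : ℝ, (u ≠ 0 ∨ v ≠ 0) ∧
      ∀ b ∈ T, u * (b 1 - a 1) - v * (b 0 - a 0) ≤ 0 := by
  have key : ∃ f : Plane →ₗ[ℝ] ℝ, f ≠ 0 ∧ ∀ b ∈ T, f b ≤ f a := by
    have hnot : a ∉ interior (convexHull ℝ T) := (hT ha).2
    have hconv : Convex ℝ (convexHull ℝ T) := convex_convexHull ℝ T
    by_cases hint : (interior (convexHull ℝ T)).Nonempty
    · obtain ⟨f, hf⟩ := geometric_hahn_banach_open_point hconv.interior isOpen_interior hnot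
      refine ⟨f.toLinearMap, ?_, fun b hb => ?_⟩
      · rintro h0
        obtain ⟨x, hx⟩ := hint
        have := hf x hx
        have e : ∀ y, f y = 0 := fun y => congrArg (fun g : Plane →ₗ[ℝ] ℝ => g y) h0
        simp [e] at this
      · have hb' : b ∈ closure (interior (convexHull ℝ T)) := by
          rw [hconv.closure_interior_eq_closure_of_nonempty_interior hint]
          exact subset_closure (subset_convexHull ℝ T hb)
        have hcl : IsClosed {x | f x ≤ f a} := isClosed_le f.continuous continuous_const
        exact closure_minimal (fun x hx => (hf x hx).le) hcl hb'
    · rw [interior_convexHull_nonempty_iff_affineSpan_eq_top] at hint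
      have hdir : (affineSpan ℝ T).direction < ⊤ := by
        rw [lt_top_iff_ne_top]
        intro h
        exact hint ((AffineSubspace.direction_eq_top_iff_of_nonempty
          ⟨a, subset_affineSpan ℝ T ha⟩).1 h)
      obtain ⟨f, hf, hle⟩ := Submodule.exists_le_ker_of_lt_top _ hdir
      refine ⟨f, hf, fun b hb => ?_⟩
      have := hle (AffineSubspace.vsub_mem_direction (subset_affineSpan ℝ T hb)
        (subset_affineSpan ℝ T ha))
      rw [LinearMap.mem_ker, vsub_eq_sub, map_sub, sub_eq_zero] at this
      exact this.le
  obtain ⟨f, hf, hs⟩ := key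
  have hexp : ∀ x : Plane, f x = x 0 * f !₂[1, 0] + x 1 * f !₂[0, 1] := by
    intro x
    have : x = x 0 • (!₂[1, 0] : Plane) + x 1 • (!₂[0, 1] : Plane) := by
      ext i; fin_cases i <;> simp
    conv_lhs => rw [this]
    simp
  -- With this choice the linear form in the goal is `f b - f a`.
  refine ⟨f !₂[0, 1], - f !₂[1, 0], ?_, fun b hb => ?_⟩
  · by_contra hcon
    push Not at hcon
    apply hf
    ext x
    rw [hexp x, hcon.1, neg_eq_zero.1 hcon.2]
    simp
  · have := hs b hb
    rw [hexp b, hexp a] at this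
    linarith

/-! ### A language of bounded loops -/

namespace RealRAM

@[simp] theorem State.setInt_int_same (s : State) (a i v : ℕ) :
    (s.setInt a i v).int a = Function.update (s.int a) i v := by
  simp [State.setInt]

theorem State.setInt_int_of_ne (s : State) {a b : ℕ} (i v : ℕ) (h : b ≠ a) :
    (s.setInt a i v).int b = s.int b := by
  simp [State.setInt, h]

@[simp] theorem State.setInt_real (s : State) (a i v : ℕ) : (s.setInt a i v).real = s.real := rfl

/-- Programs that write only integers, and whose loops run through the numbers below the contents
of cell `0` of integer array `0`, counting in cell `0` of the integer array `v`. -/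
inductive Cmd : Type where
  | skip : Cmd
  | setInt (a : ℕ) (i e : IntExpr) : Cmd
  | seq (c d : Cmd) : Cmd
  | ite (b : Test) (c d : Cmd) : Cmd
  | loop (v : ℕ) (c : Cmd) : Cmd

namespace Cmd

/-- The content of cell `0` of an array, as an expression. -/
abbrev var (v : ℕ) : IntExpr := .get v (.const 0)

/-- Translation of bounded loops into while loops. -/
def compile : Cmd → Program
  | skip => .skip
  | setInt a i e => .setInt a i e
  | seq c d => .seq c.compile d.compile
  | ite b c d => .ifThenElse b c.compile d.compile
  | loop v c => .seq (.setInt v (.const 0) (.const 0))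
      (.whileDo (.intLT (var v) (var 0))
        (.seq c.compile (.setInt v (.const 0) (.add (var v) (.const 1)))))

/-- The state after `i` iterations of a loop with body `f` and counter `v`. -/
def iterate (v : ℕ) (f : State → State) (s : State) : ℕ → State
  | 0 => s.setInt v 0 0
  | i + 1 => (f (iterate v f s i)).setInt v 0 (i + 1)

open scoped Classical in
/-- The final state. -/
noncomputable def exec : Cmd → State → State
  | skip, s => s
  | setInt a i e, s => s.setInt a (i.eval s) (e.eval s)
  | seq c d, s => d.exec (c.exec s)
  | ite b c d, s => if b.Holds s then c.exec s else d.exec s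
  | loop v c, s => iterate v c.exec s (s.int 0 0)

theorem exec_seq (c d : Cmd) (s : State) : (seq c d).exec s = d.exec (c.exec s) := rfl

theorem exec_ite_of_pos {b : Test} (c d : Cmd) {s : State} (h : b.Holds s) :
    (ite b c d).exec s = c.exec s := by
  rw [exec, if_pos h]

theorem exec_ite_of_neg {b : Test} (c d : Cmd) {s : State} (h : ¬ b.Holds s) :
    (ite b c d).exec s = d.exec s := by
  rw [exec, if_neg h]

/-- The arrays that are written to. -/
def writes : Cmd → List ℕ
  | skip => []
  | setInt a _ _ => [a]
  | seq c d => c.writes ++ d.writes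
  | ite _ c d => c.writes ++ d.writes
  | loop v c => v :: c.writes

/-- Loops do not write to their counter, and nothing writes to the bound. -/
def WF : Cmd → Prop
  | skip => True
  | setInt a _ _ => a ≠ 0
  | seq c d => c.WF ∧ d.WF
  | ite _ c d => c.WF ∧ d.WF
  | loop v c => v ≠ 0 ∧ v ∉ c.writes ∧ c.WF

/-- A bound for the running time, as a polynomial in the loop bound. -/
noncomputable def time : Cmd → Polynomial ℕ
  | skip => 1
  | setInt _ i e => .C (i.cost + e.cost + 1)
  | seq c d => c.time + d.time
  | ite b c d => .C (b.cost + 1) + c.time + d.time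
  -- Overhead: 3 to reset the counter and 6 for the final failing test; per iteration, 6 for the
  -- test and 6 for the increment.
  | loop _ c => .C 9 + .X * (c.time + .C 12)

theorem exec_int_of_notMem (c : Cmd) (s : State) {a : ℕ} (h : a ∉ c.writes) :
    (c.exec s).int a = s.int a := by
  induction c generalizing s with
  | skip => rfl
  | setInt b i e => exact State.setInt_int_of_ne s _ _ (by simpa [writes] using h)
  | seq c d ihc ihd =>
    simp only [writes, List.mem_append, not_or] at h
    rw [exec, ihd _ h.2, ihc _ h.1]
  | ite b c d ihc ihd =>
    simp only [writes, List.mem_append, not_or] at h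
    rw [exec]
    split_ifs
    · exact ihc s h.1
    · exact ihd s h.2
  | loop v c ih =>
    simp only [writes, List.mem_cons, not_or] at h
    have : ∀ i, (iterate v c.exec s i).int a = s.int a := by
      intro i
      induction i with
      | zero => exact State.setInt_int_of_ne s _ _ h.1
      | succ i ihi => rw [iterate, State.setInt_int_of_ne _ _ _ h.1, ih _ h.2, ihi]
    exact this _

theorem exec_real (c : Cmd) (s : State) : (c.exec s).real = s.real := by
  induction c generalizing s with
  | skip => rfl
  | setInt b i e => rfl
  | seq c d ihc ihd => rw [exec, ihd, ihc]
  | ite b c d ihc ihd =>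
    rw [exec]
    split_ifs
    · exact ihc s
    · exact ihd s
  | loop v c ih =>
    have : ∀ i, (iterate v c.exec s i).real = s.real := by
      intro i
      induction i with
      | zero => rfl
      | succ i ihi => rw [iterate, State.setInt_real, ih, ihi]
    exact this _

theorem WF.zero_notMem {c : Cmd} (h : c.WF) : 0 ∉ c.writes := by
  induction c with
  | skip => simp [writes]
  | setInt a i e => exact fun h' => h (List.mem_singleton.1 h').symm
  | seq c d ihc ihd => simp [writes, ihc h.1, ihd h.2]
  | ite b c d ihc ihd => simp [writes, ihc h.1, ihd h.2]
  | loop v c ih => simp [writes, ih h.2.2, h.1.symm]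

/-- Rule for loops: the arrays that are not written to may be taken from the initial state. -/
theorem exec_loop {v : ℕ} {c : Cmd} (hwf : (loop v c).WF) (s : State) (I : ℕ → State → Prop)
    (h0 : I 0 (s.setInt v 0 0))
    (hs : ∀ i t, i < s.int 0 0 → t.int v 0 = i → (∀ a, a ≠ v → a ∉ c.writes → t.int a = s.int a) →
      t.real = s.real → I i t → I (i + 1) ((c.exec t).setInt v 0 (i + 1))) :
    I (s.int 0 0) ((loop v c).exec s) := by
  have hw := hwf.2.1
  have key : ∀ i, i ≤ s.int 0 0 →
      I i (iterate v c.exec s i) ∧ (iterate v c.exec s i).int v 0 = i ∧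
      (∀ a, a ≠ v → a ∉ c.writes → (iterate v c.exec s i).int a = s.int a) ∧
      (iterate v c.exec s i).real = s.real := by
    intro i hi
    induction i with
    | zero => exact ⟨h0, by simp [iterate], fun a ha _ => State.setInt_int_of_ne _ _ _ ha, rfl⟩
    | succ i ih =>
      obtain ⟨h1, h2, h3, h4⟩ := ih (by omega)
      refine ⟨hs i _ (by omega) h2 h3 h4 h1, by simp [iterate], fun a ha ha' => ?_, ?_⟩
      · rw [iterate, State.setInt_int_of_ne _ _ _ ha, exec_int_of_notMem c _ ha', h3 a ha ha']
      · rw [iterate, State.setInt_real, exec_real, h4]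
  exact (key _ le_rfl).1

theorem runs_compile {c : Cmd} (h : c.WF) (s : State) :
    ∃ t, Runs c.compile s t (c.exec s) ∧ t ≤ c.time.eval (s.int 0 0) := by
  induction c generalizing s with
  | skip => exact ⟨1, .skip s, by simp [time]⟩
  | setInt a i e => exact ⟨_, .setInt a i e s, by simp [time]⟩
  | seq c d ihc ihd =>
    obtain ⟨t, h1, h2⟩ := ihc h.1 s
    obtain ⟨t', h3, h4⟩ := ihd h.2 (c.exec s)
    refine ⟨t + t', .seq h1 h3, ?_⟩
    rw [exec_int_of_notMem c s h.1.zero_notMem] at h4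
    simp only [time, Polynomial.eval_add]
    omega
  | ite b c d ihc ihd =>
    by_cases hb : b.Holds s
    · obtain ⟨t, h1, h2⟩ := ihc h.1 s
      refine ⟨b.cost + t + 1, ?_, ?_⟩
      · rw [exec, if_pos hb]; exact .ifTrue hb h1
      · simp only [time, Polynomial.eval_add, Polynomial.eval_C]; omega
    · obtain ⟨t, h1, h2⟩ := ihd h.2 s
      refine ⟨b.cost + t + 1, ?_, ?_⟩
      · rw [exec, if_neg hb]; exact .ifFalse hb h1
      · simp only [time, Polynomial.eval_add, Polynomial.eval_C]; omega
  | loop v c ih =>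
    obtain ⟨hv, hw, hwf⟩ := h
    have hst : ∀ i, (iterate v c.exec s i).int v 0 = i ∧
        (iterate v c.exec s i).int 0 0 = s.int 0 0 := by
      intro i
      induction i with
      | zero => exact ⟨by simp [iterate], by simp [iterate, State.setInt_int_of_ne _ _ _ hv.symm]⟩
      | succ i ih' =>
        refine ⟨by simp [iterate], ?_⟩
        rw [iterate, State.setInt_int_of_ne _ _ _ hv.symm,
          exec_int_of_notMem c _ hwf.zero_notMem, ih'.2]
    -- Induction on the number `k` of iterations still to be done, as a run of a while loop is built
    -- from its end.
    have key : ∀ k i, i + k = s.int 0 0 → ∃ t,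
        Runs (.whileDo (.intLT (var v) (var 0))
          (.seq c.compile (.setInt v (.const 0) (.add (var v) (.const 1)))))
          (iterate v c.exec s i) t (iterate v c.exec s (s.int 0 0)) ∧
        t ≤ 6 + k * (c.time.eval (s.int 0 0) + 12) := by
      intro k
      induction k with
      | zero =>
        intro i hi
        obtain rfl : i = s.int 0 0 := by omega
        refine ⟨_, .whileFalse ?_, ?_⟩
        · simp [Test.Holds, IntExpr.eval, hst]
        · simp [Test.cost, IntExpr.cost]
      | succ k ihk =>
        intro i hi
        obtain ⟨t, h1, h2⟩ := ihk (i + 1) (by omega)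
        obtain ⟨t', h3, h4⟩ := ih hwf (iterate v c.exec s i)
        rw [(hst i).2] at h4
        have hset : Runs (.setInt v (.const 0) (.add (var v) (.const 1)))
            (c.exec (iterate v c.exec s i)) 6 (iterate v c.exec s (i + 1)) := by
          have := Runs.setInt v (.const 0) (.add (var v) (.const 1))
            (c.exec (iterate v c.exec s i))
          simpa [iterate, IntExpr.eval, IntExpr.cost, exec_int_of_notMem c _ hw, (hst i).1] using this
        refine ⟨_, .whileTrue ?_ (.seq h3 hset) h1, ?_⟩
        · simp only [Test.Holds, IntExpr.eval, hst]; omega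
        · simp only [Test.cost, IntExpr.cost]
          rw [Nat.succ_mul]
          omega
    obtain ⟨t, h1, h2⟩ := key (s.int 0 0) 0 (by omega)
    refine ⟨_, .seq (.setInt v (.const 0) (.const 0) s) h1, ?_⟩
    simp only [time, Polynomial.eval_add, Polynomial.eval_C, Polynomial.eval_mul,
      Polynomial.eval_X, IntExpr.cost]
    omega

end Cmd

end RealRAM

/-! ### The greedy program -/

namespace RealRAM

namespace Cmd

/-- Lexicographic comparison of two input points. -/
def lexTest (i j : IntExpr) : Test :=
  .and (.not (.realLT (.get 0 j) (.get 0 i)))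
    (.not (.and (.not (.realLT (.get 0 i) (.get 0 j))) (.not (.realLT (.get 1 i) (.get 1 j)))))

/-- Test of `CanContinue`. -/
def continueTest (h i j : IntExpr) : Test :=
  .and
    (.not (.realLT .zero
      (.sub (.mul (.sub (.get 0 i) (.get 0 h)) (.sub (.get 1 j) (.get 1 i)))
        (.mul (.sub (.get 1 i) (.get 1 h)) (.sub (.get 0 j) (.get 0 i))))))
    (.not (.and (.not (.and (.not (lexTest i h)) (lexTest i j)))
      (.not (.and (.not (lexTest h i)) (lexTest j i)))))

theorem lexTest_holds {i j : IntExpr} {s : State} :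
    (lexTest i j).Holds s ↔ LexLT (s.real 0) (s.real 1) (i.eval s) (j.eval s) := by
  simp only [lexTest, Test.Holds, RealExpr.eval, LexLT]
  constructor
  · rintro ⟨h1, h2⟩
    by_contra h3
    push Not at h3
    refine h2 ⟨not_lt.2 h3.1, fun h4 => ?_⟩
    exact absurd h4 (not_lt.2 (h3.2 (le_antisymm (not_lt.1 h1) h3.1)))
  · rintro (h | ⟨h1, h2⟩)
    · exact ⟨h.asymm, fun h' => h'.1 h⟩
    · exact ⟨by rw [h1]; exact lt_irrefl _, fun h' => h'.2 h2⟩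

theorem continueTest_holds {h i j : IntExpr} {s : State} :
    (continueTest h i j).Holds s ↔
      CanContinue (s.real 0) (s.real 1) (h.eval s) (i.eval s) (j.eval s) := by
  simp only [continueTest, Test.Holds, RealExpr.eval, CanContinue, lexTest_holds, turnDet, not_lt]
  refine and_congr Iff.rfl ?_
  rw [not_and_or, not_not, not_not]

/-- Array `3` receives the multiples of `n`, array `4` those of `n * n`. -/
def initTables : Cmd :=
  -- The machine has no integer multiplication, so the products needed for indexing are tabulated by
  -- repeated addition.
  seq (loop 9 (setInt 3 (.add (var 9) (.const 1)) (.add (.get 3 (var 9)) (var 0))))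
    (loop 9 (setInt 4 (.add (var 9) (.const 1)) (.add (.get 4 (var 9)) (.get 3 (var 0)))))

/-- The index of the cell of the chain table for chains with `m` edges and last edge `(i, j)`. -/
def cellIndex (m i j : IntExpr) : IntExpr :=
  .add (.add (.get 4 m) (.get 3 i)) j

/-- Record `v` in the chain table, and the chain as the best one so far. -/
def record (m v : IntExpr) : Cmd :=
  seq (setInt 5 (cellIndex m (var 9) (var 10)) v)
    (seq (setInt 13 (.const 0) (.add m (.const 1)))
      (seq (setInt 14 (.const 0) (var 9)) (setInt 15 (.const 0) (var 10))))

/-- Fill a cell of the chain table for single points. -/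
def baseCell : Cmd :=
  ite (.and (.not (.intLT (var 9) (var 10))) (.and (.not (.intLT (var 10) (var 9)))
      (.intLT (.get 2 (var 10)) (.const 1))))
    (record (.const 0) (.add (var 10) (.const 1)))
    (setInt 5 (cellIndex (.const 0) (var 9) (var 10)) (.const 0))

/-- Try to extend a chain with last edge `(h, i)` to `j`. -/
def tryExtend : Cmd :=
  ite (.and (.intLT (.const 0) (.get 5 (cellIndex (var 8) (var 11) (var 9))))
      (continueTest (var 11) (var 9) (var 10)))
    (record (.add (var 8) (.const 1)) (.add (var 11) (.const 1)))
    skip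

/-- Fill a cell of the chain table for chains with at least one edge. -/
def extendCell : Cmd :=
  seq (setInt 5 (cellIndex (.add (var 8) (.const 1)) (var 9) (var 10)) (.const 0))
    (ite (.intLT (.get 2 (var 10)) (.const 1)) (loop 11 tryExtend) skip)

/-- Fill the chain table for the points that are not yet labelled. -/
def fillTable : Cmd :=
  seq (setInt 13 (.const 0) (.const 0))
    (seq (loop 9 (loop 10 baseCell)) (loop 8 (loop 9 (loop 10 extendCell))))

/-- Label the last point of the current chain and shorten the chain by it. -/
def labelLast : Cmd :=
  ite (.intLT (var 12) (var 13))
    (seq (setInt 1 (var 15) (var 6))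
      (seq (setInt 2 (var 15) (.const 1))
        -- Cells hold predecessor plus one, `0` meaning no chain. The predecessor is buffered in
        -- array `17` because both ends of the old edge are needed to find it.
        (seq (setInt 17 (.const 0) (.sub (.get 5 (cellIndex
            (.sub (var 13) (.add (var 12) (.const 1))) (var 14) (var 15))) (.const 1)))
          (seq (setInt 15 (.const 0) (var 14)) (setInt 14 (.const 0) (var 17))))))
    skip

/-- Label the points of the best chain. -/
def labelChain : Cmd :=
  ite (.intLT (.const 0) (var 13))
    (seq (loop 12 labelLast) (setInt 6 (.const 0) (.add (var 6) (.const 1))))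
    skip

/-- One round of the greedy algorithm. -/
def greedyRound : Cmd := seq fillTable labelChain

/-- The greedy algorithm; the number of labels is in cell `0` of array `6`. -/
def greedy : Cmd := seq initTables (loop 7 greedyRound)

theorem greedy_wf : greedy.WF := by
  simp [greedy, greedyRound, labelChain, labelLast, fillTable, extendCell, tryExtend, baseCell,
    record, initTables, WF, writes]

/-! ### Correctness of the chain table -/

/-- The index of a cell of the chain table. -/
def code (n m i j : ℕ) : ℕ := m * (n * n) + i * n + j

/-- `j` and `i` are the two lowest base-`n` digits; the leading part `m` needs no bound. -/
theorem code_inj {n m i j m' i' j' : ℕ} (hi : i < n) (hj : j < n) (hi' : i' < n) (hj' : j' < n)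
    (h : code n m i j = code n m' i' j') : m = m' ∧ i = i' ∧ j = j' := by
  have hn : 0 < n := by omega
  have e : ∀ a b c, code n a b c = c + n * (b + n * a) := by intros; unfold code; ring
  rw [e, e] at h
  have h1 : j = j' := by
    have := congrArg (· % n) h
    simpa [Nat.add_mul_mod_self_left, Nat.mod_eq_of_lt hj, Nat.mod_eq_of_lt hj'] using this
  subst h1
  have h2 := Nat.eq_of_mul_eq_mul_left hn (Nat.add_left_cancel h)
  have h3 : i = i' := by
    have := congrArg (· % n) h2
    simpa [Nat.add_mul_mod_self_left, Nat.mod_eq_of_lt hi, Nat.mod_eq_of_lt hi'] using this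
  subst h3
  exact ⟨Nat.eq_of_mul_eq_mul_left hn (Nat.add_left_cancel h2), rfl, rfl⟩

/-- Constant data of a round: `R` is the set of the unlabelled points. -/
structure RoundContext (n : ℕ) (X Y : ℕ → ℝ) (R : Finset ℕ) (s : State) : Prop where
  size : s.int 0 0 = n
  rows : ∀ a ≤ n, s.int 3 a = a * n
  layers : ∀ a ≤ n, s.int 4 a = a * (n * n)
  mem_iff : ∀ j, j ∈ R ↔ j < n ∧ s.int 2 j = 0
  fst : s.real 0 = X
  snd : s.real 1 = Y

theorem RoundContext.congr {n : ℕ} {X Y : ℕ → ℝ} {R : Finset ℕ} {s t : State}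
    (h : RoundContext n X Y R s) (h0 : t.int 0 = s.int 0) (h2 : t.int 2 = s.int 2)
    (h3 : t.int 3 = s.int 3) (h4 : t.int 4 = s.int 4) (hr : t.real = s.real) :
    RoundContext n X Y R t := by
  constructor
  · rw [h0, h.size]
  · rw [h3]; exact h.rows
  · rw [h4]; exact h.layers
  · rw [h2]; exact h.mem_iff
  · rw [hr, h.fst]
  · rw [hr, h.snd]

theorem RoundContext.cellIndex_eval {n : ℕ} {X Y : ℕ → ℝ} {R : Finset ℕ} {s : State}
    (h : RoundContext n X Y R s) {m i j : IntExpr} (hm : m.eval s ≤ n) (hi : i.eval s ≤ n) :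
    (cellIndex m i j).eval s = code n (m.eval s) (i.eval s) (j.eval s) := by
  simp [cellIndex, IntExpr.eval, h.rows _ hi, h.layers _ hm, code]

/-- There is a chain with `m` edges and last edge `(i, j)`. -/
def HasChain (X Y : ℕ → ℝ) (R : Finset ℕ) (m i j : ℕ) : Prop := ∃ A, ChainTo X Y R m i j A

theorem hasChain_zero {X Y : ℕ → ℝ} {R : Finset ℕ} {i j : ℕ} :
    HasChain X Y R 0 i j ↔ i = j ∧ j ∈ R := by
  constructor
  · rintro ⟨A, h⟩
    cases h with
    | single h => exact ⟨rfl, h⟩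
  · rintro ⟨rfl, h⟩
    exact ⟨_, .single h⟩

/-- The recurrence of the dynamic program: the earlier vertices do not matter for an extension. -/
theorem hasChain_succ {X Y : ℕ → ℝ} {R : Finset ℕ} {m i j : ℕ} :
    HasChain X Y R (m + 1) i j ↔ j ∈ R ∧ ∃ h, HasChain X Y R m h i ∧ CanContinue X Y h i j := by
  constructor
  · rintro ⟨A, h⟩
    cases h with
    | extend h1 h2 h3 => exact ⟨h2, _, ⟨_, h1⟩, h3⟩
  · rintro ⟨h2, h, ⟨A, h1⟩, h3⟩
    exact ⟨_, .extend h1 h2 h3⟩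

theorem HasChain.mem {X Y : ℕ → ℝ} {R : Finset ℕ} {m i j : ℕ} (h : HasChain X Y R m i j) :
    i ∈ R ∧ j ∈ R := by
  obtain ⟨A, h⟩ := h
  exact ⟨h.subset h.source_mem, h.subset h.target_mem⟩

/-- `v` is a correct content for a cell of the chain table: nonzero if the chain exists, and then
the successor of the last but two vertex. -/
def CellCorrect (X Y : ℕ → ℝ) (R : Finset ℕ) (m i j v : ℕ) : Prop :=
  (v ≠ 0 ↔ HasChain X Y R m i j) ∧
    ∀ m', m = m' + 1 → v ≠ 0 → HasChain X Y R m' (v - 1) i ∧ CanContinue X Y (v - 1) i j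

/-- The cells in `P` of the chain table are correct, and the best chain among them, which has
at most `M` edges, is recorded. -/
structure TableCorrect (n : ℕ) (X Y : ℕ → ℝ) (R : Finset ℕ) (P : ℕ → ℕ → ℕ → Prop) (M : ℕ)
    (s : State) : Prop where
  cell : ∀ m i j, i < n → j < n → P m i j → CellCorrect X Y R m i j (s.int 5 (code n m i j))
  le : s.int 13 0 ≤ M + 1
  max : ∀ m i j, i < n → j < n → P m i j → HasChain X Y R m i j → m + 1 ≤ s.int 13 0
  best : s.int 13 0 ≠ 0 → HasChain X Y R (s.int 13 0 - 1) (s.int 14 0) (s.int 15 0)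

section

variable {n : ℕ} {X Y : ℕ → ℝ} {R : Finset ℕ} {P P' : ℕ → ℕ → ℕ → Prop} {M : ℕ} {s : State}

theorem TableCorrect.mono (h : TableCorrect n X Y R P M s) {M' : ℕ}
    (hP : ∀ m i j, i < n → j < n → P' m i j → P m i j) (hM : M ≤ M') :
    TableCorrect n X Y R P' M' s :=
  ⟨fun m i j hi hj hp => h.cell m i j hi hj (hP m i j hi hj hp), by have := h.le; omega,
    fun m i j hi hj hp => h.max m i j hi hj (hP m i j hi hj hp), h.best⟩

theorem TableCorrect.congr (h : TableCorrect n X Y R P M s) {t : State} (h5 : t.int 5 = s.int 5)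
    (h13 : t.int 13 = s.int 13) (h14 : t.int 14 = s.int 14) (h15 : t.int 15 = s.int 15) :
    TableCorrect n X Y R P M t := by
  constructor
  · rw [h5]; exact h.cell
  · rw [h13]; exact h.le
  · rw [h13]; exact h.max
  · rw [h13, h14, h15]; exact h.best

theorem TableCorrect.setInt (h : TableCorrect n X Y R P M s) {v i x : ℕ} (h5 : v ≠ 5)
    (h13 : v ≠ 13) (h14 : v ≠ 14) (h15 : v ≠ 15) : TableCorrect n X Y R P M (s.setInt v i x) :=
  h.congr (State.setInt_int_of_ne _ _ _ h5.symm) (State.setInt_int_of_ne _ _ _ h13.symm)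
    (State.setInt_int_of_ne _ _ _ h14.symm) (State.setInt_int_of_ne _ _ _ h15.symm)

theorem TableCorrect.insert_none (h : TableCorrect n X Y R P M s) {m i j : ℕ} (hi : i < n)
    (hj : j < n) (hE : ¬ HasChain X Y R m i j) {t : State}
    (h5 : t.int 5 = Function.update (s.int 5) (code n m i j) 0) (h13 : t.int 13 0 = s.int 13 0)
    (h14 : t.int 14 0 = s.int 14 0) (h15 : t.int 15 0 = s.int 15 0)
    (hP : ∀ m' i' j', i' < n → j' < n → P' m' i' j' → P m' i' j' ∨ (m' = m ∧ i' = i ∧ j' = j)) :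
    TableCorrect n X Y R P' M t := by
  constructor
  · intro m' i' j' hi' hj' hp
    by_cases he : m' = m ∧ i' = i ∧ j' = j
    · obtain ⟨rfl, rfl, rfl⟩ := he
      rw [h5, Function.update_self]
      exact ⟨by simp [hE], by simp⟩
    · rw [h5, Function.update_of_ne fun h' => he (code_inj hi' hj' hi hj h')]
      exact h.cell m' i' j' hi' hj' ((hP m' i' j' hi' hj' hp).resolve_right he)
  · rw [h13]; exact h.le
  · intro m' i' j' hi' hj' hp hE'
    rw [h13]
    rcases hP m' i' j' hi' hj' hp with h' | ⟨rfl, rfl, rfl⟩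
    · exact h.max m' i' j' hi' hj' h' hE'
    · exact absurd hE' hE
  · rw [h13, h14, h15]; exact h.best

/-- The record is overwritten without comparison: the previous best has at most `M + 1` points, and
the new chain has exactly that many. -/
theorem TableCorrect.insert_some (h : TableCorrect n X Y R P M s) {i j v : ℕ} (hi : i < n)
    (hj : j < n) (hv : v ≠ 0) (hE : CellCorrect X Y R M i j v) {t : State}
    (h5 : t.int 5 = Function.update (s.int 5) (code n M i j) v) (h13 : t.int 13 0 = M + 1)
    (h14 : t.int 14 0 = i) (h15 : t.int 15 0 = j)
    (hP : ∀ m' i' j', i' < n → j' < n → P' m' i' j' → P m' i' j' ∨ (m' = M ∧ i' = i ∧ j' = j)) :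
    TableCorrect n X Y R P' M t := by
  constructor
  · intro m' i' j' hi' hj' hp
    by_cases he : m' = M ∧ i' = i ∧ j' = j
    · obtain ⟨rfl, rfl, rfl⟩ := he
      rw [h5, Function.update_self]
      exact hE
    · rw [h5, Function.update_of_ne fun h' => he (code_inj hi' hj' hi hj h')]
      exact h.cell m' i' j' hi' hj' ((hP m' i' j' hi' hj' hp).resolve_right he)
  · rw [h13]
  · intro m' i' j' hi' hj' hp hE'
    rw [h13]
    rcases hP m' i' j' hi' hj' hp with h' | ⟨rfl, rfl, rfl⟩
    · exact (h.max m' i' j' hi' hj' h' hE').trans h.le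
    · exact le_rfl
  · rw [h13, h14, h15]
    exact fun _ => hE.1.1 hv

theorem baseCell_spec (hc : RoundContext n X Y R s) (h : TableCorrect n X Y R P 0 s)
    (hi : s.int 9 0 < n) (hj : s.int 10 0 < n)
    (hP : ∀ m' i' j', i' < n → j' < n → P' m' i' j' →
      P m' i' j' ∨ (m' = 0 ∧ i' = s.int 9 0 ∧ j' = s.int 10 0)) :
    TableCorrect n X Y R P' 0 (baseCell.exec s) := by
  have hidx : (cellIndex (.const 0) (var 9) (var 10)).eval s
      = code n 0 (s.int 9 0) (s.int 10 0) :=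
    hc.cellIndex_eval (by simp [IntExpr.eval]) (by simpa [IntExpr.eval] using hi.le)
  have hmem := hc.mem_iff (s.int 10 0)
  simp only [hj, true_and] at hmem
  rw [baseCell, exec]
  split_ifs with ht
  · simp only [Test.Holds, IntExpr.eval] at ht
    refine h.insert_some hi hj (Nat.succ_ne_zero (s.int 10 0)) ?_ ?_ ?_ ?_ ?_ hP
    · refine ⟨?_, by simp⟩
      rw [hasChain_zero, hmem]
      simp only [ne_eq, Nat.succ_ne_zero, not_false_eq_true, true_iff]
      omega
    all_goals simp [record, exec, State.setInt_int_of_ne, IntExpr.eval, hidx]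
  · simp only [Test.Holds, IntExpr.eval] at ht
    refine h.insert_none hi hj (m := 0) ?_ ?_ ?_ ?_ ?_ hP
    · rw [hasChain_zero, hmem]
      omega
    all_goals simp [exec, State.setInt_int_of_ne, IntExpr.eval, hidx]

theorem tryExtend_loop_spec (hc : RoundContext n X Y R s) (hm : s.int 8 0 < n)
    (hi : s.int 9 0 < n) (hj : s.int 10 0 < n) :
    ((∀ h < n, 0 < s.int 5 (code n (s.int 8 0) h (s.int 9 0)) →
        ¬ CanContinue X Y h (s.int 9 0) (s.int 10 0)) ∧
      ((loop 11 tryExtend).exec s).int 5 = s.int 5 ∧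
      ((loop 11 tryExtend).exec s).int 13 0 = s.int 13 0 ∧
      ((loop 11 tryExtend).exec s).int 14 0 = s.int 14 0 ∧
      ((loop 11 tryExtend).exec s).int 15 0 = s.int 15 0) ∨
    ∃ h < n, (0 < s.int 5 (code n (s.int 8 0) h (s.int 9 0)) ∧
        CanContinue X Y h (s.int 9 0) (s.int 10 0)) ∧
      ((loop 11 tryExtend).exec s).int 5 = Function.update (s.int 5)
        (code n (s.int 8 0 + 1) (s.int 9 0) (s.int 10 0)) (h + 1) ∧
      ((loop 11 tryExtend).exec s).int 13 0 = s.int 8 0 + 2 ∧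
      ((loop 11 tryExtend).exec s).int 14 0 = s.int 9 0 ∧
      ((loop 11 tryExtend).exec s).int 15 0 = s.int 10 0 := by
  have hwf : (loop 11 tryExtend).WF := by
    simp [tryExtend, record, WF, writes]
  have key := exec_loop hwf s (fun H t =>
    ((∀ h < H, 0 < s.int 5 (code n (s.int 8 0) h (s.int 9 0)) →
        ¬ CanContinue X Y h (s.int 9 0) (s.int 10 0)) ∧
      t.int 5 = s.int 5 ∧ t.int 13 0 = s.int 13 0 ∧ t.int 14 0 = s.int 14 0 ∧
      t.int 15 0 = s.int 15 0) ∨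
    ∃ h < n, (0 < s.int 5 (code n (s.int 8 0) h (s.int 9 0)) ∧
        CanContinue X Y h (s.int 9 0) (s.int 10 0)) ∧
      t.int 5 = Function.update (s.int 5)
        (code n (s.int 8 0 + 1) (s.int 9 0) (s.int 10 0)) (h + 1) ∧
      t.int 13 0 = s.int 8 0 + 2 ∧ t.int 14 0 = s.int 9 0 ∧ t.int 15 0 = s.int 10 0) ?_ ?_
  · rwa [hc.size] at key
  · left
    simp [State.setInt_int_of_ne]
  · intro H t hH h11 hframe hreal hI
    rw [hc.size] at hH
    have hct : RoundContext n X Y R t := hc.congr (hframe 0 (by simp) (by simp [tryExtend, record, writes]))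
      (hframe 2 (by simp) (by simp [tryExtend, record, writes]))
      (hframe 3 (by simp) (by simp [tryExtend, record, writes]))
      (hframe 4 (by simp) (by simp [tryExtend, record, writes])) hreal
    have h8 : t.int 8 = s.int 8 := hframe 8 (by simp) (by simp [tryExtend, record, writes])
    have h9 : t.int 9 = s.int 9 := hframe 9 (by simp) (by simp [tryExtend, record, writes])
    have h10 : t.int 10 = s.int 10 := hframe 10 (by simp) (by simp [tryExtend, record, writes])
    -- The loop reads one layer and writes to the next, so its reads see the initial table.
    have hne : code n (s.int 8 0) H (s.int 9 0) ≠
        code n (s.int 8 0 + 1) (s.int 9 0) (s.int 10 0) := by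
      intro h'
      have := (code_inj hH hi hi hj h').1
      omega
    have hold : t.int 5 (code n (s.int 8 0) H (s.int 9 0)) =
        s.int 5 (code n (s.int 8 0) H (s.int 9 0)) := by
      rcases hI with hI | ⟨h, -, -, hI, -⟩
      · rw [hI.2.1]
      · rw [hI, Function.update_of_ne hne]
    have hupd : ∀ v, Function.update (t.int 5)
        (code n (s.int 8 0 + 1) (s.int 9 0) (s.int 10 0)) v = Function.update (s.int 5)
        (code n (s.int 8 0 + 1) (s.int 9 0) (s.int 10 0)) v := by
      intro v
      rcases hI with hI | ⟨h, -, -, hI, -⟩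
      · rw [hI.2.1]
      · rw [hI, Function.update_idem]
    have hidx : (cellIndex (var 8) (var 11) (var 9)).eval t
        = code n (s.int 8 0) H (s.int 9 0) := by
      rw [hct.cellIndex_eval (by simp [IntExpr.eval, h8, hm.le])
        (by simp [IntExpr.eval, h11, hH.le])]
      simp [IntExpr.eval, h8, h9, h11]
    have hidx' : (cellIndex (.add (var 8) (.const 1)) (var 9) (var 10)).eval t
        = code n (s.int 8 0 + 1) (s.int 9 0) (s.int 10 0) := by
      rw [hct.cellIndex_eval (by simp [IntExpr.eval, h8]; omega)
        (by simp [IntExpr.eval, h9, hi.le])]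
      simp [IntExpr.eval, h8, h9, h10]
    have htest : (Test.and (.intLT (.const 0) (.get 5 (cellIndex (var 8) (var 11) (var 9))))
        (continueTest (var 11) (var 9) (var 10))).Holds t ↔
        0 < s.int 5 (code n (s.int 8 0) H (s.int 9 0)) ∧
          CanContinue X Y H (s.int 9 0) (s.int 10 0) := by
      simp only [Test.Holds, continueTest_holds, IntExpr.eval, hidx, hold, h9, h10, h11,
        hct.fst, hct.snd]
    by_cases hg : 0 < s.int 5 (code n (s.int 8 0) H (s.int 9 0)) ∧
        CanContinue X Y H (s.int 9 0) (s.int 10 0)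
    · rw [tryExtend, exec_ite_of_pos _ _ (htest.2 hg)]
      right
      refine ⟨H, hH, hg, ?_⟩
      simp [record, exec, State.setInt_int_of_ne, IntExpr.eval, hidx', h8, h9, h10, h11, hupd]
    · rw [tryExtend, exec_ite_of_neg _ _ (fun h => hg (htest.1 h)), exec]
      rcases hI with ⟨hI, hrest⟩ | hI
      · left
        refine ⟨fun h hh hpos hcan => ?_, by simpa [State.setInt_int_of_ne] using hrest⟩
        rcases Nat.lt_succ_iff_lt_or_eq.1 hh with hh | rfl
        · exact hI h hh hpos hcan
        · exact hg ⟨hpos, hcan⟩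
      · right
        simpa [State.setInt_int_of_ne] using hI

/-- The cell is cleared first because it may hold an entry of an earlier round; then it stays `0`
exactly if no predecessor fits. -/
theorem extendCell_spec (hc : RoundContext n X Y R s) {m : ℕ} (hm : s.int 8 0 = m) (hmn : m < n)
    (h : TableCorrect n X Y R P (m + 1) s) (hi : s.int 9 0 < n) (hj : s.int 10 0 < n)
    (hlayer : ∀ h i, P m h i)
    (hP : ∀ m' i' j', i' < n → j' < n → P' m' i' j' →
      P m' i' j' ∨ (m' = m + 1 ∧ i' = s.int 9 0 ∧ j' = s.int 10 0)) :
    TableCorrect n X Y R P' (m + 1) (extendCell.exec s) := by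
  subst hm
  have hidx : (cellIndex (.add (var 8) (.const 1)) (var 9) (var 10)).eval s
      = code n (s.int 8 0 + 1) (s.int 9 0) (s.int 10 0) := by
    rw [hc.cellIndex_eval (by simp [IntExpr.eval]; omega) (by simp [IntExpr.eval, hi.le])]
    simp [IntExpr.eval]
  have hmem := hc.mem_iff (s.int 10 0)
  simp only [hj, true_and] at hmem
  rw [extendCell, exec_seq]
  generalize hs' : exec (Cmd.setInt 5 (cellIndex (.add (var 8) (.const 1)) (var 9) (var 10))
    (.const 0)) s = s'
  rw [exec, hidx] at hs'
  have h5 : s'.int 5 = Function.update (s.int 5)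
      (code n (s.int 8 0 + 1) (s.int 9 0) (s.int 10 0)) 0 := by
    rw [← hs', State.setInt_int_same]; rfl
  have hframe : ∀ a, a ≠ 5 → s'.int a = s.int a := by
    intro a ha
    rw [← hs', State.setInt_int_of_ne _ _ _ ha]
  have hne : ∀ h < n, s'.int 5 (code n (s.int 8 0) h (s.int 9 0)) =
      s.int 5 (code n (s.int 8 0) h (s.int 9 0)) := by
    intro h hh
    rw [h5, Function.update_of_ne]
    intro h'
    have := (code_inj hh hi hi hj h').1
    omega
  by_cases ht : Test.Holds s' (.intLT (.get 2 (var 10)) (.const 1))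
  · rw [exec_ite_of_pos _ _ ht]
    simp only [Test.Holds, IntExpr.eval, hframe 2 (by simp), hframe 10 (by simp),
      Nat.lt_one_iff] at ht
    have hR := hmem.2 ht
    have hc' : RoundContext n X Y R s' := hc.congr (hframe 0 (by simp)) (hframe 2 (by simp))
      (hframe 3 (by simp)) (hframe 4 (by simp)) (by rw [← hs']; rfl)
    have hspec := tryExtend_loop_spec hc' (by rwa [hframe 8 (by simp)])
      (by rwa [hframe 9 (by simp)]) (by rwa [hframe 10 (by simp)])
    rw [hframe 8 (by simp), hframe 9 (by simp), hframe 10 (by simp), hframe 13 (by simp),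
      hframe 14 (by simp), hframe 15 (by simp)] at hspec
    rcases hspec with ⟨hno, h5', h13, h14, h15⟩ | ⟨a, ha, ⟨hpos, hcan⟩, h5', h13, h14, h15⟩
    · refine h.insert_none hi hj ?_ (h5'.trans h5) h13 h14 h15 hP
      rw [hasChain_succ]
      rintro ⟨-, a, hch, hcan⟩
      have ha : a < n := ((hc.mem_iff a).1 hch.mem.1).1
      refine hno a ha ?_ hcan
      rw [hne a ha]
      exact Nat.pos_of_ne_zero ((h.cell _ a _ ha hi (hlayer _ _)).1.2 hch)
    · rw [hne a ha] at hpos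
      have hch := (h.cell _ a _ ha hi (hlayer _ _)).1.1 hpos.ne'
      refine h.insert_some hi hj (Nat.succ_ne_zero a) ⟨?_, ?_⟩ ?_ h13 h14 h15 hP
      · simp only [ne_eq, Nat.succ_ne_zero, not_false_eq_true, true_iff]
        exact hasChain_succ.2 ⟨hR, a, hch, hcan⟩
      · intro m' hm' _
        obtain rfl : s.int 8 0 = m' := by omega
        exact ⟨hch, hcan⟩
      · rw [h5', h5, Function.update_idem]
  · rw [exec_ite_of_neg _ _ ht, exec]
    simp only [Test.Holds, IntExpr.eval, hframe 2 (by simp), hframe 10 (by simp),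
      Nat.lt_one_iff] at ht
    refine h.insert_none hi hj ?_ h5 ?_ ?_ ?_ hP
    · rw [hasChain_succ]
      exact fun h' => ht (hmem.1 h'.1)
    · rw [hframe 13 (by simp)]
    · rw [hframe 14 (by simp)]
    · rw [hframe 15 (by simp)]

theorem RoundContext.exec {c : Cmd} (hc : RoundContext n X Y R s) (h0 : 0 ∉ c.writes)
    (h2 : 2 ∉ c.writes) (h3 : 3 ∉ c.writes) (h4 : 4 ∉ c.writes) :
    RoundContext n X Y R (c.exec s) :=
  hc.congr (exec_int_of_notMem _ _ h0) (exec_int_of_notMem _ _ h2) (exec_int_of_notMem _ _ h3)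
    (exec_int_of_notMem _ _ h4) (exec_real _ _)

theorem RoundContext.of_frame {l : List ℕ} {v : ℕ} {t : State} (hc : RoundContext n X Y R s)
    (hframe : ∀ a, a ≠ v → a ∉ l → t.int a = s.int a) (hr : t.real = s.real)
    (hl : ∀ a ∈ v :: l, a ≠ 0 ∧ a ≠ 2 ∧ a ≠ 3 ∧ a ≠ 4) : RoundContext n X Y R t := by
  refine hc.congr (hframe _ ?_ ?_) (hframe _ ?_ ?_) (hframe _ ?_ ?_) (hframe _ ?_ ?_) hr
  · exact fun h => (hl v (by simp)).1 h.symm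
  · exact fun h => (hl 0 (by simp [h])).1 rfl
  · exact fun h => (hl v (by simp)).2.1 h.symm
  · exact fun h => (hl 2 (by simp [h])).2.1 rfl
  · exact fun h => (hl v (by simp)).2.2.1 h.symm
  · exact fun h => (hl 3 (by simp [h])).2.2.1 rfl
  · exact fun h => (hl v (by simp)).2.2.2 h.symm
  · exact fun h => (hl 4 (by simp [h])).2.2.2 rfl

theorem baseLayer_spec (hc : RoundContext n X Y R s)
    (h : TableCorrect n X Y R (fun _ _ _ => False) 0 s) :
    TableCorrect n X Y R (fun m _ _ => m ≤ 0) 0 ((loop 9 (loop 10 baseCell)).exec s) := by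
  have hwf : (loop 9 (loop 10 baseCell)).WF := by simp [baseCell, record, WF, writes]
  have key := exec_loop hwf s
    (fun i t => TableCorrect n X Y R (fun m i' _ => m = 0 ∧ i' < i) 0 t) ?_ ?_
  · refine key.mono (fun m i j hi _ hm => ⟨by omega, ?_⟩) le_rfl
    rwa [hc.size]
  · exact (h.mono (by simp) le_rfl).setInt (by simp) (by simp) (by simp) (by simp)
  · intro i t hi h9 hframe hreal hI
    rw [hc.size] at hi
    have hct := hc.of_frame hframe hreal (by simp [baseCell, record, writes])
    refine TableCorrect.setInt ?_ (by simp) (by simp) (by simp) (by simp)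
    have key := exec_loop hwf.2.2 t (fun j u => TableCorrect n X Y R
      (fun m i' j' => m = 0 ∧ (i' < i ∨ (i' = i ∧ j' < j))) 0 u) ?_ ?_
    · refine key.mono (fun m i' j' hi' hj' hm => ?_) le_rfl
      rw [hct.size]
      omega
    · exact (hI.mono (fun m i' j' _ _ hm => by omega) le_rfl).setInt (by simp) (by simp) (by simp)
        (by simp)
    · intro j u hj h10 hframe' hreal' hJ
      rw [hct.size] at hj
      have hcu := hct.of_frame hframe' hreal' (by simp [baseCell, record, writes])
      have h9' : u.int 9 0 = i := by
        rw [hframe' 9 (by simp) (by simp [baseCell, record, writes]), h9]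
      refine TableCorrect.setInt ?_ (by simp) (by simp) (by simp) (by simp)
      refine baseCell_spec hcu hJ (by omega) (by omega) fun m' i' j' _ _ hp => ?_
      omega

theorem extendLayers_spec (hc : RoundContext n X Y R s)
    (h : TableCorrect n X Y R (fun m _ _ => m ≤ 0) 0 s) :
    TableCorrect n X Y R (fun m _ _ => m ≤ n) n
      ((loop 8 (loop 9 (loop 10 extendCell))).exec s) := by
  have hwf : (loop 8 (loop 9 (loop 10 extendCell))).WF := by
    simp [extendCell, tryExtend, record, WF, writes]
  have key := exec_loop hwf s
    (fun m t => TableCorrect n X Y R (fun m' _ _ => m' ≤ m) m t) ?_ ?_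
  · rwa [hc.size] at key
  · exact h.setInt (by simp) (by simp) (by simp) (by simp)
  · intro m r hm h8 hframe hreal hM
    rw [hc.size] at hm
    have hcr := hc.of_frame hframe hreal (by simp [extendCell, tryExtend, record, writes])
    refine TableCorrect.setInt ?_ (by simp) (by simp) (by simp) (by simp)
    have key := exec_loop hwf.2.2 r (fun i t => TableCorrect n X Y R
      (fun m' i' _ => m' ≤ m ∨ (m' = m + 1 ∧ i' < i)) (m + 1) t) ?_ ?_
    · refine key.mono (fun m' i j hi _ hm => ?_) le_rfl
      rw [hcr.size]
      omega
    · exact (hM.mono (fun m' i j _ _ hm => by omega) (by omega)).setInt (by simp) (by simp)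
        (by simp) (by simp)
    · intro i t hi h9 hframe hreal hI
      rw [hcr.size] at hi
      have hct := hcr.of_frame hframe hreal (by simp [extendCell, tryExtend, record, writes])
      have h8' : t.int 8 0 = m := by
        rw [hframe 8 (by simp) (by simp [extendCell, tryExtend, record, writes]), h8]
      refine TableCorrect.setInt ?_ (by simp) (by simp) (by simp) (by simp)
      have key := exec_loop hwf.2.2.2.2 t (fun j u => TableCorrect n X Y R
        (fun m' i' j' => m' ≤ m ∨ (m' = m + 1 ∧ (i' < i ∨ (i' = i ∧ j' < j)))) (m + 1) u) ?_ ?_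
      · refine key.mono (fun m' i' j' hi' hj' hm => ?_) le_rfl
        rw [hct.size]
        omega
      · exact (hI.mono (fun m' i' j' _ _ hm => by omega) le_rfl).setInt (by simp) (by simp)
          (by simp) (by simp)
      · intro j u hj h10 hframe' hreal' hJ
        rw [hct.size] at hj
        have hcu := hct.of_frame hframe' hreal' (by simp [extendCell, tryExtend, record, writes])
        have h8'' : u.int 8 0 = m := by
          rw [hframe' 8 (by simp) (by simp [extendCell, tryExtend, record, writes]), h8']
        have h9' : u.int 9 0 = i := by
          rw [hframe' 9 (by simp) (by simp [extendCell, tryExtend, record, writes]), h9]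
        refine TableCorrect.setInt ?_ (by simp) (by simp) (by simp) (by simp)
        refine extendCell_spec hcu h8'' hm hJ (by omega) (by omega) (fun _ _ => Or.inl le_rfl)
          fun m' i' j' _ _ hp => ?_
        omega

/-- Nothing is assumed about the old table: once the best length is reset, correctness on the empty
set of cells is vacuous. -/
theorem fillTable_spec (hc : RoundContext n X Y R s) :
    TableCorrect n X Y R (fun m _ _ => m ≤ n) n (fillTable.exec s) := by
  have hc1 : RoundContext n X Y R (s.setInt 13 0 0) :=
    hc.exec (c := setInt 13 (.const 0) (.const 0)) (by simp [writes]) (by simp [writes])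
      (by simp [writes]) (by simp [writes])
  have h1 : TableCorrect n X Y R (fun _ _ _ => False) 0 (s.setInt 13 0 0) :=
    ⟨by simp, by simp, by simp, by simp⟩
  have h2 := baseLayer_spec hc1 h1
  exact extendLayers_spec (hc1.exec (by simp [baseCell, record, writes])
    (by simp [baseCell, record, writes]) (by simp [baseCell, record, writes])
    (by simp [baseCell, record, writes])) h2

end

end Cmd

end RealRAM

/-! ### Labelling a longest chain, and the greedy invariant -/

namespace RealRAM

namespace Cmd

section

variable {n : ℕ} {X Y : ℕ → ℝ} {R : Finset ℕ} {s : State}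

theorem initTables_spec (h3 : s.int 3 0 = 0) (h4 : s.int 4 0 = 0) (hn : s.int 0 0 = n) :
    (∀ a ≤ n, (initTables.exec s).int 3 a = a * n) ∧
      ∀ a ≤ n, (initTables.exec s).int 4 a = a * (n * n) := by
  have hwf : initTables.WF := by simp [initTables, WF, writes]
  rw [initTables, exec_seq]
  have key1 := exec_loop hwf.1 s (fun i t => ∀ a ≤ i, t.int 3 a = a * n)
    (by simpa [State.setInt_int_of_ne] using h3) (by
      intro i t hi h9 hframe _ hI a ha
      have h0 : t.int 0 = s.int 0 := hframe 0 (by simp) (by simp [writes])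
      rcases Nat.le_succ_iff.1 ha with ha | rfl
      · have hne : a ≠ i + 1 := by omega
        simpa [exec, State.setInt_int_of_ne, IntExpr.eval, h9, hne] using hI a ha
      · simp [exec, State.setInt_int_of_ne, IntExpr.eval, h9, hI i le_rfl, h0, hn]
        ring)
  generalize hs' : exec (loop 9 (setInt 3 (.add (var 9) (.const 1))
    (.add (.get 3 (var 9)) (var 0)))) s = s' at key1 ⊢
  have hframe : ∀ a, a ≠ 9 → a ≠ 3 → s'.int a = s.int a := by
    intro a h h'
    rw [← hs']
    exact exec_int_of_notMem _ _ (by simp [writes, h, h'])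
  have hn' : s'.int 0 0 = n := by rw [hframe 0 (by simp) (by simp), hn]
  rw [hn] at key1
  constructor
  · intro a ha
    rw [exec_int_of_notMem _ _ (by simp [writes])]
    exact key1 a ha
  · have key2 := exec_loop hwf.2 s' (fun i t => ∀ a ≤ i, t.int 4 a = a * (n * n))
      (by simpa [State.setInt_int_of_ne, hframe 4] using h4) (by
        intro i t hi h9 hframe _ hI a ha
        have h0 : t.int 0 = s'.int 0 := hframe 0 (by simp) (by simp [writes])
        have h3 : t.int 3 = s'.int 3 := hframe 3 (by simp) (by simp [writes])
        rcases Nat.le_succ_iff.1 ha with ha | rfl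
        · have hne : a ≠ i + 1 := by omega
          simpa [exec, State.setInt_int_of_ne, IntExpr.eval, h9, hne] using hI a ha
        · simp [exec, State.setInt_int_of_ne, IntExpr.eval, h9, hI i le_rfl, h0, h3, hn',
            key1 n le_rfl]
          ring)
    rwa [hn'] at key2

theorem labelLast_loop_spec (hc : RoundContext n X Y R s)
    (ht : TableCorrect n X Y R (fun m _ _ => m ≤ n) n s) (h0 : 0 < s.int 13 0)
    (hle : s.int 13 0 ≤ n) :
    ∃ D, ChainTo X Y R (s.int 13 0 - 1) (s.int 14 0) (s.int 15 0) D ∧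
      ((loop 12 labelLast).exec s).int 1 = (fun x => if x ∈ D then s.int 6 0 else s.int 1 x) ∧
      ((loop 12 labelLast).exec s).int 2 = (fun x => if x ∈ D then 1 else s.int 2 x) := by
  have hwf : (loop 12 labelLast).WF := by simp [labelLast, WF, writes]
  -- The table certifies only that a remaining chain exists, not which one. Hence the invariant:
  -- every chain with the remaining length and last edge completes the labelled points `D` to a
  -- chain of full length.
  have key := exec_loop hwf s (fun l t => ∃ D : Finset ℕ,
    (l < s.int 13 0 → HasChain X Y R (s.int 13 0 - 1 - l) (t.int 14 0) (t.int 15 0) ∧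
      ∀ B, ChainTo X Y R (s.int 13 0 - 1 - l) (t.int 14 0) (t.int 15 0) B →
        ChainTo X Y R (s.int 13 0 - 1) (s.int 14 0) (s.int 15 0) (D ∪ B)) ∧
    (s.int 13 0 ≤ l → ChainTo X Y R (s.int 13 0 - 1) (s.int 14 0) (s.int 15 0) D) ∧
    t.int 1 = (fun x => if x ∈ D then s.int 6 0 else s.int 1 x) ∧
    t.int 2 = (fun x => if x ∈ D then 1 else s.int 2 x)) ?_ ?_
  · rw [hc.size] at key
    obtain ⟨D, -, hD, h1, h2⟩ := key
    exact ⟨D, hD hle, h1, h2⟩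
  · refine ⟨∅, ?_⟩
    simp only [State.setInt_int_of_ne, ne_eq, Nat.reduceEqDiff,
      not_false_eq_true, OfNat.one_ne_ofNat, Finset.empty_union, Finset.notMem_empty, if_false,
      Nat.sub_zero, imp_self, implies_true, and_true]
    exact ⟨fun _ => ht.best h0.ne', fun h => by omega⟩
  · intro l t hl h12 hframe hreal ⟨D, hlt, hge, h1, h2⟩
    rw [hc.size] at hl
    have f : ∀ a, a ≠ 12 → a ∉ labelLast.writes → t.int a = s.int a := hframe
    have h3 := f 3 (by simp) (by simp [labelLast, writes])
    have h4 := f 4 (by simp) (by simp [labelLast, writes])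
    have h5 := f 5 (by simp) (by simp [labelLast, writes])
    have h6 := f 6 (by simp) (by simp [labelLast, writes])
    have h13 := f 13 (by simp) (by simp [labelLast, writes])
    by_cases hlb : l < s.int 13 0
    · obtain ⟨hch, hext⟩ := hlt hlb
      have hi : t.int 14 0 < n := ((hc.mem_iff _).1 hch.mem.1).1
      have hj : t.int 15 0 < n := ((hc.mem_iff _).1 hch.mem.2).1
      have htest : Test.Holds t (.intLT (var 12) (var 13)) := by
        simpa [Test.Holds, IntExpr.eval, h12, h13] using hlb
      have hcell := ht.cell (s.int 13 0 - 1 - l) _ _ hi hj (by omega)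
      have hv : s.int 5 (code n (s.int 13 0 - 1 - l) (t.int 14 0) (t.int 15 0)) ≠ 0 :=
        hcell.1.2 hch
      have e : s.int 13 0 - (l + 1) = s.int 13 0 - 1 - l := by omega
      have hpred : s.int 5 (s.int 4 (s.int 13 0 - (l + 1)) + s.int 3 (t.int 14 0) + t.int 15 0)
          = s.int 5 (code n (s.int 13 0 - 1 - l) (t.int 14 0) (t.int 15 0)) := by
        rw [hc.layers _ (by omega), hc.rows _ hi.le, e, code]
      rw [labelLast, exec_ite_of_pos _ _ htest]
      refine ⟨insert (t.int 15 0) D, ?_, ?_, ?_, ?_⟩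
      · intro hl1
        simp only [exec, cellIndex, IntExpr.eval, State.setInt_int_same, State.setInt_int_of_ne,
          ne_eq, Nat.reduceEqDiff, not_false_eq_true, OfNat.ofNat_ne_one,
          Function.update_self, h3, h4, h5, h12, h13, hpred]
        obtain ⟨m', hm'⟩ : ∃ m', s.int 13 0 - 1 - l = m' + 1 := ⟨s.int 13 0 - 2 - l, by omega⟩
        have hm'' : s.int 13 0 - 1 - (l + 1) = m' := by omega
        obtain ⟨hp, hcan⟩ := hcell.2 m' hm' hv
        rw [hm''] at *
        refine ⟨hp, fun B hB => ?_⟩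
        have := hext (insert (t.int 15 0) B) (by
          rw [hm']
          exact hB.extend hch.mem.2 hcan)
        rwa [Finset.insert_union, ← Finset.union_insert]
      · intro hl1
        have hm0 : s.int 13 0 - 1 - l = 0 := by omega
        rw [hm0] at hch hext
        obtain ⟨hij, hmem⟩ := hasChain_zero.1 hch
        have := hext {t.int 15 0} (by rw [hij]; exact .single hmem)
        rwa [Finset.insert_eq, Finset.union_comm]
      · simp only [exec, IntExpr.eval, State.setInt_int_same, State.setInt_int_of_ne,
          ne_eq, OfNat.one_ne_ofNat, not_false_eq_true, h1, h6]
        funext x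
        by_cases hx : x = t.int 15 0 <;> simp [hx]
      · simp only [exec, IntExpr.eval, State.setInt_int_same, State.setInt_int_of_ne,
          ne_eq, Nat.reduceEqDiff, OfNat.ofNat_ne_one, not_false_eq_true, h2]
        funext x
        by_cases hx : x = t.int 15 0 <;> simp [hx]
    · have htest : ¬ Test.Holds t (.intLT (var 12) (var 13)) := by
        simpa [Test.Holds, IntExpr.eval, h12, h13] using hlb
      rw [labelLast, exec_ite_of_neg _ _ htest, exec]
      refine ⟨D, fun h => by omega, fun _ => hge (by omega), ?_, ?_⟩
      · rw [State.setInt_int_of_ne _ _ _ (by simp), h1]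
      · rw [State.setInt_int_of_ne _ _ _ (by simp), h2]

/-- A round does nothing if all points are labelled, and otherwise gives a new label to the points
of a longest chain of unlabelled points. -/
theorem greedyRound_spec (hc : RoundContext n X Y R s) :
    (R = ∅ ∧ (greedyRound.exec s).int 1 = s.int 1 ∧ (greedyRound.exec s).int 2 = s.int 2 ∧
      (greedyRound.exec s).int 6 0 = s.int 6 0) ∨
    ∃ m i j A, ChainTo X Y R m i j A ∧
      (∀ m' i' j' B, ChainTo X Y R m' i' j' B → m' + 1 ≤ m + 1) ∧
      (greedyRound.exec s).int 1 = (fun x => if x ∈ A then s.int 6 0 else s.int 1 x) ∧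
      (greedyRound.exec s).int 2 = (fun x => if x ∈ A then 1 else s.int 2 x) ∧
      (greedyRound.exec s).int 6 0 = s.int 6 0 + 1 := by
  have ht := fillTable_spec hc
  have hw : ∀ a ∈ fillTable.writes, a = 5 ∨ 8 ≤ a := by
    simp [fillTable, baseCell, extendCell, tryExtend, record, writes]
  have hf : ∀ a < 8, a ≠ 5 → (fillTable.exec s).int a = s.int a := by
    intro a ha ha5
    refine exec_int_of_notMem _ _ fun h => ?_
    have := hw a h
    omega
  rw [greedyRound, exec_seq]
  have hc' : RoundContext n X Y R (fillTable.exec s) :=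
    hc.congr (hf _ (by simp) (by simp)) (hf _ (by simp) (by simp)) (hf _ (by simp) (by simp))
      (hf _ (by simp) (by simp)) (exec_real _ _)
  rw [← hf 1 (by simp) (by simp), ← hf 2 (by simp) (by simp), ← hf 6 (by simp) (by simp)]
  generalize fillTable.exec s = s' at *
  have hRn : R ⊆ Finset.range n := fun x hx => Finset.mem_range.2 ((hc.mem_iff x).1 hx).1
  have hlen : ∀ m i j B, ChainTo X Y R m i j B → m + 1 ≤ n := by
    intro m i j B hB
    have := Finset.card_le_card (hB.subset.trans hRn)
    rwa [hB.card_eq, Finset.card_range] at this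
  have hbest : ∀ m i j B, ChainTo X Y R m i j B → m + 1 ≤ s'.int 13 0 := by
    intro m i j B hB
    have := hlen m i j B hB
    exact ht.max m i j (Finset.mem_range.1 (hRn (hB.subset hB.source_mem)))
      (Finset.mem_range.1 (hRn (hB.subset hB.target_mem))) (by omega) ⟨B, hB⟩
  by_cases h0 : 0 < s'.int 13 0
  · right
    obtain ⟨A, hA⟩ := ht.best h0.ne'
    have hle : s'.int 13 0 ≤ n := by have := hlen _ _ _ _ hA; omega
    obtain ⟨D, hD, h1, h2⟩ := labelLast_loop_spec hc' ht h0 hle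
    have h6 : ((loop 12 labelLast).exec s').int 6 = s'.int 6 :=
      exec_int_of_notMem _ _ (by simp [labelLast, writes])
    have htest : Test.Holds s' (.intLT (.const 0) (var 13)) := by
      simpa [Test.Holds, IntExpr.eval] using h0
    refine ⟨_, _, _, D, hD, fun m i j B hB => ?_, ?_, ?_, ?_⟩
    · have := hbest m i j B hB
      omega
    all_goals rw [labelChain, exec_ite_of_pos _ _ htest, exec_seq, exec]
    · rw [State.setInt_int_of_ne _ _ _ (by simp), h1]
    · rw [State.setInt_int_of_ne _ _ _ (by simp), h2]
    · simp [IntExpr.eval, h6]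
  · left
    have htest : ¬ Test.Holds s' (.intLT (.const 0) (var 13)) := by
      simpa [Test.Holds, IntExpr.eval] using h0
    rw [labelChain, exec_ite_of_neg _ _ htest, exec]
    refine ⟨?_, rfl, rfl, rfl⟩
    refine Finset.eq_empty_of_forall_notMem fun x hx => ?_
    have := hbest 0 x x {x} (.single hx)
    omega

/-- The invariant of the greedy algorithm after `r` rounds; every round leaves at most the
fraction `q` of the unlabelled points. -/
structure GreedyInvariant (n : ℕ) (X Y : ℕ → ℝ) (q : ℝ) (r : ℕ) (R : Finset ℕ) (s : State) :
    Prop where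
  context : RoundContext n X Y R s
  label_lt : ∀ i < n, i ∉ R → s.int 1 i < s.int 6 0
  supported : ∀ c, Supported X Y ((Finset.range n).filter fun i => i ∉ R ∧ s.int 1 i = c)
  progress : R = ∅ ∨ R.card + r ≤ n
  -- The exponent counts labels, not rounds, since rounds after the last labelling are idle.
  card_le : (R.card : ℝ) ≤ n * q ^ s.int 6 0
  -- Some point was still unlabelled just before the latest label was issued.
  last : s.int 6 0 = 0 ∨ 1 ≤ (n : ℝ) * q ^ (s.int 6 0 - 1)

theorem GreedyInvariant.round {q : ℝ} {r : ℕ} (h : GreedyInvariant n X Y q r R s) (hq0 : 0 ≤ q)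
    (hq : ∀ K : ℕ, (∀ m i j B, ChainTo X Y R m i j B → m + 1 ≤ K) →
      (R.card : ℝ) * (1 - q) ≤ K) :
    ∃ R', GreedyInvariant n X Y q (r + 1) R' (greedyRound.exec s) := by
  have hw : ∀ a ∈ greedyRound.writes, a ≠ 0 ∧ a ≠ 3 ∧ a ≠ 4 := by
    simp [greedyRound, labelChain, labelLast, fillTable, baseCell, extendCell, tryExtend, record,
      writes]
  have hf0 : (greedyRound.exec s).int 0 = s.int 0 :=
    exec_int_of_notMem _ _ fun h => (hw _ h).1 rfl
  have hf3 : (greedyRound.exec s).int 3 = s.int 3 :=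
    exec_int_of_notMem _ _ fun h => (hw _ h).2.1 rfl
  have hf4 : (greedyRound.exec s).int 4 = s.int 4 :=
    exec_int_of_notMem _ _ fun h => (hw _ h).2.2 rfl
  have hr : (greedyRound.exec s).real = s.real := exec_real _ _
  have hc := h.context
  rcases greedyRound_spec hc with ⟨rfl, h1, h2, h6⟩ | ⟨m, i, j, A, hA, hmax, h1, h2, h6⟩
  · refine ⟨∅, hc.congr hf0 h2 hf3 hf4 hr, ?_, ?_, Or.inl rfl, ?_, ?_⟩
    · rw [h1, h6]; exact h.label_lt
    · rw [h1]; exact h.supported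
    · rw [h6]; exact h.card_le
    · rw [h6]; exact h.last
  · have hAR := hA.subset
    have hcard : (R \ A).card + (m + 1) = R.card := by
      rw [← hA.card_eq]
      exact Finset.card_sdiff_add_card_eq_card hAR
    have hne : R ≠ ∅ := by
      rintro rfl
      simp at hcard
    refine ⟨R \ A, ⟨?_, ?_, ?_, ?_, ?_, ?_⟩, ?_, ?_, ?_, ?_, ?_⟩
    · rw [hf0, hc.size]
    · rw [hf3]; exact hc.rows
    · rw [hf4]; exact hc.layers
    · intro x
      rw [Finset.mem_sdiff, hc.mem_iff, h2]
      by_cases hx : x ∈ A <;> simp [hx]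
    · rw [hr, hc.fst]
    · rw [hr, hc.snd]
    · intro x hx hxR
      rw [h1, h6]
      by_cases hxA : x ∈ A
      · simp [hxA]
      · have := h.label_lt x hx (fun h' => hxR (Finset.mem_sdiff.2 ⟨h', hxA⟩))
        simp only [hxA, if_false]
        omega
    · intro c
      rw [h1]
      -- The class of the fresh label lies in the new chain because all older labels are smaller;
      -- the other classes gain no points.
      by_cases hck : c = s.int 6 0
      · refine hA.supported.mono fun x hx => ?_
        by_contra hxA
        simp only [Finset.mem_filter, Finset.mem_range, Finset.mem_sdiff, hxA, not_false_eq_true,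
          and_true, if_false] at hx
        have := h.label_lt x hx.1 hx.2.1
        omega
      · refine (h.supported c).mono fun x hx => ?_
        simp only [Finset.mem_filter, Finset.mem_range, Finset.mem_sdiff] at hx ⊢
        by_cases hxA : x ∈ A
        · simp only [hxA, if_true] at hx
          exact absurd hx.2.2.symm hck
        · simpa [hxA] using hx
    · right
      have := h.progress.resolve_left hne
      omega
    · have h3 := hq (m + 1) hmax
      have h4 : ((R \ A).card : ℝ) + ((m + 1 : ℕ) : ℝ) = R.card := by exact_mod_cast hcard
      rw [h6, pow_succ]
      have h5 := mul_le_mul_of_nonneg_right h.card_le hq0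
      linarith
    · right
      rw [h6, Nat.add_sub_cancel]
      have : (1 : ℝ) ≤ R.card := by
        exact_mod_cast Finset.card_pos.2 (Finset.nonempty_iff_ne_empty.2 hne)
      exact this.trans h.card_le

theorem greedy_spec {q : ℝ} (hq0 : 0 ≤ q)
    (hq : ∀ R ⊆ Finset.range n, ∀ K : ℕ, (∀ m i j B, ChainTo X Y R m i j B → m + 1 ≤ K) →
      (R.card : ℝ) * (1 - q) ≤ K)
    (hn : s.int 0 0 = n) (hz : ∀ a, a ≠ 0 → s.int a = 0) (hX : s.real 0 = X)
    (hY : s.real 1 = Y) :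
    (∀ i < n, (greedy.exec s).int 1 i < (greedy.exec s).int 6 0) ∧
      (∀ c, Supported X Y ((Finset.range n).filter fun i => (greedy.exec s).int 1 i = c)) ∧
      ((greedy.exec s).int 6 0 = 0 ∨ 1 ≤ (n : ℝ) * q ^ ((greedy.exec s).int 6 0 - 1)) := by
  have hinit := initTables_spec (by rw [hz 3 (by simp)]; rfl) (by rw [hz 4 (by simp)]; rfl) hn
  have hf : ∀ a, a ≠ 3 → a ≠ 4 → a ≠ 9 → (initTables.exec s).int a = s.int a :=
    fun a h h' h'' => exec_int_of_notMem _ _ (by simp [initTables, writes, h, h', h''])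
  have hr : (initTables.exec s).real = s.real := exec_real _ _
  rw [greedy, exec_seq]
  generalize initTables.exec s = s' at *
  have hn' : s'.int 0 0 = n := by rw [hf 0 (by simp) (by simp) (by simp), hn]
  have h6 : s'.int 6 0 = 0 := by rw [hf 6 (by simp) (by simp) (by simp), hz 6 (by simp)]; rfl
  have hmem : ∀ j, j ∈ Finset.range n ↔ j < n ∧ s'.int 2 j = 0 := by
    intro j
    rw [hf 2 (by simp) (by simp) (by simp), hz 2 (by simp)]
    simp
  have hc : RoundContext n X Y (Finset.range n) s' :=
    ⟨hn', hinit.1, hinit.2, hmem, by rw [hr, hX], by rw [hr, hY]⟩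
  have hI : GreedyInvariant n X Y q 0 (Finset.range n) s' := by
    refine ⟨hc, fun i hi hi' => absurd (Finset.mem_range.2 hi) hi', fun c a ha => ?_, ?_, ?_,
      Or.inl h6⟩
    · simp only [Finset.mem_filter] at ha
      exact absurd ha.1 ha.2.1
    · simp
    · simp [h6]
  have key := exec_loop greedy_wf.2 s' (fun r t => ∃ R, GreedyInvariant n X Y q r R t) ?_ ?_
  · obtain ⟨R, h⟩ := key
    rw [hn'] at h
    have hR : R = ∅ := by
      rcases h.progress with h' | h'
      · exact h'
      · exact Finset.card_eq_zero.1 (by omega)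
    subst hR
    exact ⟨fun i hi => h.label_lt i hi (by simp), by simpa using h.supported, h.last⟩
  · refine ⟨_, hI.context.congr ?_ ?_ ?_ ?_ rfl, ?_, ?_, hI.progress, ?_, ?_⟩
    all_goals simp only [State.setInt_int_of_ne, ne_eq, Nat.reduceEqDiff,
      not_false_eq_true, OfNat.one_ne_ofNat, OfNat.zero_ne_ofNat]
    · exact hI.label_lt
    · exact hI.supported
    · exact hI.card_le
    · exact hI.last
  · intro r t _ _ _ _ ⟨R, h⟩
    obtain ⟨R', h'⟩ := h.round hq0
      (hq R fun x hx => Finset.mem_range.2 ((h.context.mem_iff x).1 hx).1)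
    refine ⟨R', h'.context.congr ?_ ?_ ?_ ?_ rfl, ?_, ?_, h'.progress, ?_, ?_⟩
    all_goals simp only [State.setInt_int_of_ne, ne_eq, Nat.reduceEqDiff,
      not_false_eq_true, OfNat.one_ne_ofNat, OfNat.zero_ne_ofNat]
    · exact h'.label_lt
    · exact h'.supported
    · exact h'.card_le
    · exact h'.last

end

end Cmd

end RealRAM

/-! ### Convex covers -/

/-- An infimum in `ℕ` is attained once the set is nonempty; the singletons provide a cover. -/
theorem exists_isConvexCover_ncard_eq {S : Set Plane} (hS : S.Finite) :
    ∃ F : Set (Set Plane), IsConvexCover S F ∧ F.Finite ∧ F.ncard = convexCoverNumber S := by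
  have hne : {k : ℕ | ∃ F : Set (Set Plane), IsConvexCover S F ∧ F.Finite ∧ F.ncard = k}.Nonempty := by
    refine ⟨_, (fun x => {x}) '' S, ⟨?_, ?_, ?_⟩, hS.image _, rfl⟩
    · rintro _ ⟨x, hx, rfl⟩
      simpa using hx
    · rintro _ ⟨x, hx, rfl⟩
      refine convexPosition_of_support fun a ha => ⟨1, 0, by simp, fun b hb => ?_⟩
      rw [Set.mem_singleton_iff.1 ha, Set.mem_singleton_iff.1 hb]
      simp
    · exact fun x hx => ⟨{x}, ⟨x, hx, rfl⟩, rfl⟩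
  exact Nat.sInf_mem hne

theorem convexCoverNumber_le {S : Set Plane} {F : Set (Set Plane)} (hF : IsConvexCover S F)
    (hfin : F.Finite) : convexCoverNumber S ≤ F.ncard :=
  Nat.sInf_le ⟨F, hF, hfin, rfl⟩

section

variable {n : ℕ} (p : Fin n → Plane)

theorem RealRAM.inputState_real_zero (i : Fin n) : (RealRAM.inputState p).real 0 i = p i 0 := by
  simp [RealRAM.inputState]

theorem RealRAM.inputState_real_one (i : Fin n) : (RealRAM.inputState p).real 1 i = p i 1 := by
  simp [RealRAM.inputState]

/-- A set of input points has at most `3 κ` times as many points as its longest chain. -/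
theorem card_le_of_chains (hp : Function.Injective p) {R : Finset ℕ} (hR : R ⊆ Finset.range n)
    {K : ℕ} (hK : ∀ m i j B, ChainTo ((RealRAM.inputState p).real 0)
      ((RealRAM.inputState p).real 1) R m i j B → m + 1 ≤ K) :
    R.card ≤ convexCoverNumber (Set.range p) * (3 * K) := by
  classical
  obtain ⟨F, hF, hfin, hcard⟩ := exists_isConvexCover_ncard_eq (Set.finite_range p)
  have hdist : DistinctPoints ((RealRAM.inputState p).real 0) ((RealRAM.inputState p).real 1) R := by
    intro i hi j hj hx hy
    have hi' := Finset.mem_range.1 (hR hi)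
    have hj' := Finset.mem_range.1 (hR hj)
    have hx' : p ⟨i, hi'⟩ 0 = p ⟨j, hj'⟩ 0 := by
      simpa only [← RealRAM.inputState_real_zero] using hx
    have hy' : p ⟨i, hi'⟩ 1 = p ⟨j, hj'⟩ 1 := by
      simpa only [← RealRAM.inputState_real_one] using hy
    have := @hp ⟨i, hi'⟩ ⟨j, hj'⟩ (by ext k; fin_cases k; exacts [hx', hy'])
    simpa using this
  -- Each member of an optimal cover meets `R` in a supported set, hence in at most `3 * K` points.
  have hcover : R ⊆ hfin.toFinset.biUnion fun T => R.filter fun i => ∃ h : i < n, p ⟨i, h⟩ ∈ T := by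
    intro i hi
    have hi' := Finset.mem_range.1 (hR hi)
    obtain ⟨T, hT, hiT⟩ := hF.covers ⟨⟨i, hi'⟩, rfl⟩
    exact Finset.mem_biUnion.2 ⟨T, hfin.mem_toFinset.2 hT, Finset.mem_filter.2 ⟨hi, hi', hiT⟩⟩
  refine (Finset.card_le_card hcover).trans ?_
  rw [← hcard, Set.ncard_eq_toFinset_card F hfin]
  refine Finset.card_biUnion_le_card_mul _ _ _ fun T hT => ?_
  refine Supported.card_le hdist (Finset.filter_subset _ _) ?_ hK
  intro a ha
  obtain ⟨-, ha', haT⟩ := Finset.mem_filter.1 ha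
  obtain ⟨u, v, hne, hs⟩ := (hF.convexPosition T (hfin.mem_toFinset.1 hT)).exists_support haT
  refine ⟨u, v, hne, fun b hb => ?_⟩
  obtain ⟨-, hb', hbT⟩ := Finset.mem_filter.1 hb
  have := hs _ hbT
  simpa only [← RealRAM.inputState_real_zero, ← RealRAM.inputState_real_one] using this

theorem isConvexCover_labelClass {s : RealRAM.State} {k : ℕ} (hlt : ∀ i < n, s.label i < k)
    (hs : ∀ c, Supported ((RealRAM.inputState p).real 0) ((RealRAM.inputState p).real 1)
      ((Finset.range n).filter fun i => s.label i = c)) :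
    IsConvexCover (Set.range p) (labelClass p s '' Set.Iio k) := by
  refine ⟨?_, ?_, ?_⟩
  · rintro _ ⟨c, -, rfl⟩ _ ⟨i, rfl, -⟩
    exact ⟨i, rfl⟩
  · rintro _ ⟨c, -, rfl⟩
    refine convexPosition_of_support ?_
    rintro _ ⟨i, rfl, hi⟩
    obtain ⟨u, v, hne, hsup⟩ := hs c i (by simp [hi])
    refine ⟨u, v, hne, ?_⟩
    rintro _ ⟨j, rfl, hj⟩
    have := hsup j (by simp [hj])
    simpa only [RealRAM.inputState_real_zero, RealRAM.inputState_real_one] using this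
  · rintro _ ⟨i, rfl⟩
    exact ⟨_, ⟨s.label i, hlt i i.2, rfl⟩, i, rfl, rfl⟩

end

/-! ### The logarithmic bound and the main theorem -/

/-- The number of rounds of a greedy cover in which every round but the last leaves at most the
fraction `1 - 1 / (3 κ)` of the elements. -/
theorem greedy_rounds_le {n k κ : ℕ} (hκ : 0 < κ)
    (h : k = 0 ∨ 1 ≤ (n : ℝ) * (1 - 1 / (3 * κ)) ^ (k - 1)) :
    (k : ℝ) ≤ (1 + 3 * Real.log n) * κ := by
  have hκ1 : (1 : ℝ) ≤ κ := by exact_mod_cast hκ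
  rcases h with rfl | h
  · have := Real.log_natCast_nonneg n
    push_cast
    positivity
  · have hq : 0 ≤ 1 - 1 / (3 * (κ : ℝ)) := by
      rw [sub_nonneg, div_le_one (by positivity)]
      linarith
    have hle : (1 - 1 / (3 * (κ : ℝ))) ^ (k - 1) ≤ Real.exp (-(1 / (3 * κ)) * (k - 1 : ℕ)) := by
      rw [mul_comm (-_) _, Real.exp_nat_mul]
      exact pow_le_pow_left₀ hq (Real.one_sub_le_exp_neg _) _
    have hn : (0 : ℝ) < n := by
      by_contra hcon
      have : (n : ℝ) = 0 := le_antisymm (not_lt.1 hcon) (Nat.cast_nonneg n)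
      rw [this, zero_mul] at h
      linarith
    have h1 := h.trans (mul_le_mul_of_nonneg_left hle hn.le)
    have h2 := Real.log_le_log one_pos h1
    rw [Real.log_one, Real.log_mul hn.ne' (Real.exp_ne_zero _), Real.log_exp] at h2
    have h3 : ((k - 1 : ℕ) : ℝ) / (3 * κ) ≤ Real.log n := by
      have e : -(1 / (3 * (κ : ℝ))) * ((k - 1 : ℕ) : ℝ) = -(((k - 1 : ℕ) : ℝ) / (3 * κ)) := by ring
      rw [e] at h2
      linarith
    rw [div_le_iff₀ (by positivity)] at h3
    have h4 : (k : ℝ) ≤ ((k - 1 : ℕ) : ℝ) + 1 := by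
      have : k ≤ k - 1 + 1 := by omega
      exact_mod_cast this
    -- The final `+ 1` is absorbed by `κ ≥ 1`.
    nlinarith

/-- One real RAM program computes, for every set `S` of `n` points in the plane, in time polynomial
in `n`, a number `k` with `κ_c(S) ≤ k ≤ (1 + C log n) κ_c(S)`, together with a convex cover of `S`
by the `k` label classes `0, …, k - 1`. -/
theorem theorem12 :
    ∃ (prog : RealRAM.Program) (time : Polynomial ℕ) (C : ℝ),
      ∀ (n : ℕ) (p : Fin n → Plane), Function.Injective p →
        ∃ (t : ℕ) (s : RealRAM.State),
          RealRAM.Runs prog (RealRAM.inputState p) t s ∧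
          t ≤ time.eval n ∧
          convexCoverNumber (Set.range p) ≤ s.number ∧
          (s.number : ℝ) ≤ (1 + C * Real.log n) * convexCoverNumber (Set.range p) ∧
          IsConvexCover (Set.range p) (labelClass p s '' Set.Iio s.number) := by
  -- The output cell holds the loop bound `n` until the end, so the number of labels is copied there
  -- last, at cost 4.
  refine ⟨.seq RealRAM.Cmd.greedy.compile (.setInt 0 (.const 0) (RealRAM.Cmd.var 6)),
    RealRAM.Cmd.greedy.time + .C 4, 3, fun n p hp => ?_⟩
  have hsize : (RealRAM.inputState p).int 0 0 = n := by simp [RealRAM.inputState]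
  obtain ⟨t, hrun, htime⟩ := RealRAM.Cmd.runs_compile RealRAM.Cmd.greedy_wf (RealRAM.inputState p)
  rw [hsize] at htime
  set κ := convexCoverNumber (Set.range p) with hκdef
  have hκ : 0 < n → 0 < κ := by
    intro hn
    -- The trivial bound `K = n` gives `n ≤ κ * (3 * n)`, so `κ` cannot vanish.
    have h := card_le_of_chains p hp (R := Finset.range n) subset_rfl (K := n) (by
      intro m i j B hB
      have := Finset.card_le_card hB.subset
      rwa [hB.card_eq, Finset.card_range] at this)
    rw [Finset.card_range, ← hκdef] at h
    by_contra hcon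
    have : κ = 0 := by omega
    simp [this] at h
    omega
  have hspec := RealRAM.Cmd.greedy_spec (n := n) (s := RealRAM.inputState p)
    (q := 1 - 1 / (3 * κ)) (by
      rw [sub_nonneg]
      -- For `κ = 0` division by zero gives `q = 1`, and the requirements on `q` are trivial.
      rcases Nat.eq_zero_or_pos κ with h | h
      · simp [h]
      · have : (1 : ℝ) ≤ κ := by exact_mod_cast h
        rw [div_le_one (by positivity)]
        linarith) (by
      intro R hR K hK
      have h := card_le_of_chains p hp hR hK
      rw [← hκdef] at h
      rcases Nat.eq_zero_or_pos κ with h0 | h0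
      · simp [h0]
      · have h' : (R.card : ℝ) ≤ κ * (3 * K) := by exact_mod_cast h
        have h0' : (0 : ℝ) < κ := by exact_mod_cast h0
        rw [sub_sub_cancel, mul_one_div, div_le_iff₀ (by positivity)]
        linarith) hsize (by
      intro a ha
      funext i
      simp [RealRAM.inputState, ha]) rfl rfl
  obtain ⟨hlt, hsup, hlast⟩ := hspec
  generalize RealRAM.Cmd.greedy.exec (RealRAM.inputState p) = s at *
  have hnum : (s.setInt 0 0 (s.int 6 0)).number = s.int 6 0 := by
    simp [RealRAM.State.number]
  have hlab : ∀ i, (s.setInt 0 0 (s.int 6 0)).label i = s.int 1 i := fun i => by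
    simp [RealRAM.State.label, RealRAM.State.setInt_int_of_ne]
  have hcov := isConvexCover_labelClass p (s := s.setInt 0 0 (s.int 6 0)) (k := s.int 6 0)
    (by simpa only [hlab] using hlt) (by simpa only [hlab] using hsup)
  refine ⟨_, _, .seq hrun (.setInt 0 (.const 0) (RealRAM.Cmd.var 6) s), ?_, ?_, ?_, ?_⟩
  · simp only [RealRAM.IntExpr.cost, Polynomial.eval_add, Polynomial.eval_C]
    omega
  · refine le_of_le_of_eq ?_ hnum.symm
    refine (convexCoverNumber_le hcov ((Set.finite_Iio _).image _)).trans ?_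
    refine (Set.ncard_image_le (Set.finite_Iio _)).trans ?_
    simp [Set.ncard_eq_toFinset_card']
  · change (((s.setInt 0 0 (s.int 6 0)).number : ℕ) : ℝ) ≤ _
    rw [hnum]
    rcases Nat.eq_zero_or_pos n with rfl | hn
    · have : s.int 6 0 = 0 := by
        rcases hlast with h | h
        · exact h
        · norm_num at h
      simp [this]
    · exact greedy_rounds_le (hκ hn) hlast
  · change IsConvexCover _ (labelClass p (s.setInt 0 0 (s.int 6 0)) ''
      Set.Iio (s.setInt 0 0 (s.int 6 0)).number)
    rw [hnum]
    exact hcov
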